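/- **Setting.** Let $\mathcal S,\mathcal A$ be non-empty finite sets and consider a discounted Markov decision process with transition probabilities $P(s,a,s')$, deterministic reward function $r(s,a,s')$ with $|r|\le 1$, and discount factor $\gamma\in[0,1)$. Let $Q^*$ be its optimal Q-function, $Q^*(s,a)=\max_\pi \mathbb E[\sum_{k\ge0}\gamma^k r_k\mid s_0=s,a_0=a,\pi]$, the maximum being over deterministic policies $\pi:\mathcal S\to\mathcal A$. Let $\beta(a|s)$ be a fixed behaviour policy for which the state-action chain with transition matrix $K((s,a),(s',a'))=P(s,a,s')\beta(a'|s')$ is irreducible and aperiodic, let $\mu_\infty$ be its stationary distribution, $d_{\min}=\min_{s,a}\mu_\infty(s,a)$, $d_{\max}=\max_{s,a}\mu_\infty(s,a)$. Geometric mixing with constants $m>0$, $\rho\in(0,1)$ means $d_{\mathrm{TV}}(K^k(x,\cdot),\mu_\infty)\le m\rho^k$ for all $k\in\mathbb N=\{0,1,2,\dots\}$ and all initial state-action pairs $x$, where $d_{\mathrm{TV}}(p,q)=\max_E|p(E)-q(E)|$. Given such constants and a step-size $\alpha_k=\theta/(k+\xi)$, put $\tau^{\mathrm{mix}}(c')=\min\{k\in\mathbb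 N: m\rho^k\le c'\}$ and $K_{\mathrm{mix}}=\min\{k: t\ge 2\tau^{\mathrm{mix}}(\alpha_t)\ \forall t\ge k\}$. Let $(s_k,a_k)_{k\ge0}$ be a Markov chain with transition matrix $K$ and arbitrary initial law, let $Q_0$ be deterministic with $\|Q_0\|_\infty\le1$, and let $Q_k$ be produced by asynchronous Q-learning (no projection): $Q_{k+1}(s_k,a_k)=Q_k(s_k,a_k)+\alpha_k\big(r(s_k,a_k,s_{k+1})+\gamma\max_u Q_k(s_{k+1},u)-Q_k(s_k,a_k)\big)$, all other entries being unchanged. Let $Q^L_0$ be any deterministic vector (the initial point of a lower comparison system) with $\|Q_0^L\|_\infty\le1$ and $Q_0^L\le Q_0$ entrywise, for example $Q_0^L=Q_0$. **Theorem.** For every constant $c$ there is a constant $C>0$ depending only on $c$ such that the following holds in every such setting. 1. Constants $m>0,\rho\in(0,1)$ of geometric mixing exist. 2. For all such $m,\rho$ and all step-sizes $\alpha_k=\theta/(k+\xi)$ with $$\frac{2}{(1-\gamma)d_{\min}}\le\theta\le \frac{c\,|\mathcal S||\mathcal A|}{(1-\gamma)d_{\min}},\qquad \theta\le\xi\le c\left(\frac{|\mathcal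 S||\mathcal A|}{(1-\gamma)d_{\min}}\right)^{6},$$ the random variables $\|Q_k-Q^*\|_\infty$ are integrable, and for every $k\ge K_{\mathrm{mix}}$ $$\mathbb E\|Q_k-Q^*\|_\infty\le\frac{C^*}{\sqrt{k+\xi}}+\frac{C(|\mathcal S||\mathcal A|)^{33/8}d_{\max}}{(1-\gamma)^4d_{\min}^3}\,\frac{\sqrt{\tau^{\mathrm{mix}}(\alpha_k)}}{\sqrt{k+\xi}},$$ where $$C^*=C\max\left\{\frac{(|\mathcal S||\mathcal A|)^4d_{\max}^{5/2}}{(1-\gamma)^{5/2}d_{\min}^{5/2}}\|Q_0^L-Q^*\|_2,\ \frac{(|\mathcal S||\mathcal A|)^{15/4}}{(1-\gamma)^4d_{\min}^3}\right\}.$$ 3. Moreover, for each fixed such instance, $\tau^{\mathrm{mix}}(\alpha_k)=O(\log k)$ and $\mathbb E\|Q_k-Q^*\|_\infty=O\big(\sqrt{\log k/k}\big)$ as $k\to\infty$. -/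

import Mathlib

open MeasureTheory Filter Asymptotics

noncomputable section

namespace QLearning

/-- A discounted Markov decision process on finite sets of states and actions:
`P s a s'` is the probability of moving from `s` to `s'` under action `a`, and `r s a s'` is the
(deterministic) reward which that transition incurs. -/
structure MDP (S A : Type*) [Fintype S] where
  P : S → A → S → ℝ
  P_nonneg : ∀ s a s', 0 ≤ P s a s'
  P_sum : ∀ s a, ∑ s', P s a s' = 1
  r : S → A → S → ℝ
  γ : ℝ
  γ_nonneg : 0 ≤ γ
  γ_lt_one : γ < 1

/-- A stationary randomized policy; `prob s a` is the probability of action `a` in state `s`. -/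
structure Policy (S A : Type*) [Fintype A] where
  prob : S → A → ℝ
  nonneg : ∀ s a, 0 ≤ prob s a
  sum_eq_one : ∀ s, ∑ a, prob s a = 1

section

variable {S A : Type*} [Fintype S] [Fintype A] [DecidableEq S] [DecidableEq A]

/-- The expected one-step reward of a state-action pair. -/
def expReward (M : MDP S A) (x : S × A) : ℝ := ∑ s', M.P x.1 x.2 s' * M.r x.1 x.2 s'

/-- Transition matrix of the state-action chain under the deterministic policy `π`. -/
def detKernel (M : MDP S A) (π : S → A) : Matrix (S × A) (S × A) ℝ :=
  fun x y => if y.2 = π y.1 then M.P x.1 x.2 y.1 else 0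

/-- The Q-function `𝔼[∑ₖ γᵏ rₖ | (s₀, a₀) = x]` of the deterministic policy `π`. -/
def qPolicy (M : MDP S A) (π : S → A) (x : S × A) : ℝ :=
  ∑' k : ℕ, M.γ ^ k * (detKernel M π ^ k).mulVec (expReward M) x

/-- The optimal Q-function: the largest Q-function among the (finitely many) deterministic
policies. -/
def qStar (M : MDP S A) (x : S × A) : ℝ := ⨆ π : S → A, qPolicy M π x

/-- Transition matrix of the state-action chain under the behaviour policy `β`. -/
def chain (M : MDP S A) (β : Policy S A) : Matrix (S × A) (S × A) ℝ :=
  fun x y => M.P x.1 x.2 y.1 * β.prob y.1 y.2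

/-- Every state has period one, i.e. `1` is the only common divisor of its return times. -/
def IsAperiodic {ι : Type*} [Fintype ι] [DecidableEq ι] (K : Matrix ι ι ℝ) : Prop :=
  ∀ x, ∀ d : ℕ, (∀ k, 0 < (K ^ k) x x → d ∣ k) → d = 1

/-- `μ` is a stationary probability distribution of the transition matrix `K`. -/
structure IsStationary {ι : Type*} [Fintype ι] (K : Matrix ι ι ℝ) (μ : ι → ℝ) : Prop where
  nonneg : ∀ x, 0 ≤ μ x
  sum_eq_one : ∑ x, μ x = 1
  invariant : Matrix.vecMul μ K = μ

/-- Total variation distance `max_E |p(E) - q(E)|` of two distributions on a finite set. -/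
def tvDist {ι : Type*} (p q : ι → ℝ) : ℝ :=
  ⨆ E : Finset ι, |∑ x ∈ E, p x - ∑ x ∈ E, q x|

/-- Geometric mixing with constants `m > 0` and `ρ ∈ (0,1)`: from every initial state, the law
after `k` steps is within `m ρᵏ` of `μ` in total variation. -/
structure GeometricMixing {ι : Type*} [Fintype ι] [DecidableEq ι]
    (K : Matrix ι ι ℝ) (μ : ι → ℝ) (m ρ : ℝ) : Prop where
  m_pos : 0 < m
  ρ_pos : 0 < ρ
  ρ_lt_one : ρ < 1
  bound : ∀ (k : ℕ) (x : ι), tvDist (fun y => (K ^ k) x y) μ ≤ m * ρ ^ k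

/-- The mixing time `min {k | m ρᵏ ≤ c}`. -/
def mixTime (m ρ c : ℝ) : ℕ := sInf {k : ℕ | m * ρ ^ k ≤ c}

/-- The step-size `αₖ = θ / (k + ξ)`. -/
def stepSize (θ ξ : ℝ) (k : ℕ) : ℝ := θ / (k + ξ)

/-- `K_mix = min {k | t ≥ 2 τ(αₜ) for all t ≥ k}`. -/
def kMix (m ρ : ℝ) (α : ℕ → ℝ) : ℕ := sInf {k : ℕ | ∀ t, k ≤ t → 2 * mixTime m ρ (α t) ≤ t}

/-- `X` is a Markov chain on the finite set `ι` with transition matrix `K`, started from an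
arbitrary initial distribution. -/
structure IsMarkovChain {ι Ω : Type*} [MeasurableSpace Ω] (ℙ : Measure Ω)
    (K : Matrix ι ι ℝ) (X : ℕ → Ω → ι) : Prop where
  meas : ∀ k x, MeasurableSet {ω | X k ω = x}
  step : ∀ (k : ℕ) (x : ℕ → ι),
    ℙ.real {ω | ∀ i ≤ k + 1, X i ω = x i}
      = ℙ.real {ω | ∀ i ≤ k, X i ω = x i} * K (x k) (x (k + 1))

/-- Asynchronous Q-learning along the observed path `x k = (sₖ, aₖ)`:
`Qₖ₊₁(sₖ,aₖ) = Qₖ(sₖ,aₖ) + αₖ (r(sₖ,aₖ,sₖ₊₁) + γ maxᵤ Qₖ(sₖ₊₁,u) - Qₖ(sₖ,aₖ))`, and all other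
entries are left unchanged. -/
def qIter (M : MDP S A) (α : ℕ → ℝ) (Q₀ : S × A → ℝ) (x : ℕ → S × A) : ℕ → S × A → ℝ
  | 0 => Q₀
  | k + 1 => fun y =>
      let Q := qIter M α Q₀ x k
      if y = x k then
        Q y + α k * (M.r (x k).1 (x k).2 (x (k + 1)).1
          + M.γ * (⨆ u : A, Q ((x (k + 1)).1, u)) - Q y)
      else Q y

/-- The maximum norm. -/
def supNorm {ι : Type*} (v : ι → ℝ) : ℝ := ⨆ x, |v x|

/-- The Euclidean norm. -/
def l2Norm {ι : Type*} [Fintype ι] (v : ι → ℝ) : ℝ := √(∑ x, v x ^ 2)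

/-- The number `|S| |A|` of state-action pairs. -/
def nPairs (S A : Type*) [Fintype S] [Fintype A] : ℝ := Fintype.card S * Fintype.card A

/-- The smallest stationary state-action probability. -/
def dMin {ι : Type*} (μ : ι → ℝ) : ℝ := ⨅ x, μ x

/-- The largest stationary state-action probability. -/
def dMax {ι : Type*} (μ : ι → ℝ) : ℝ := ⨆ x, μ x

/-- The constant `C*` of the convergence rate. -/
def cStar (M : MDP S A) (μ : S × A → ℝ) (QL₀ : S × A → ℝ) (C : ℝ) : ℝ :=
  C * max
    (nPairs S A ^ (4 : ℕ) * dMax μ ^ (5 / 2 : ℝ)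
        / ((1 - M.γ) ^ (5 / 2 : ℝ) * dMin μ ^ (5 / 2 : ℝ)) * l2Norm (QL₀ - qStar M))
    (nPairs S A ^ (15 / 4 : ℝ) / ((1 - M.γ) ^ (4 : ℕ) * dMin μ ^ (3 : ℕ)))

end

end QLearning

end

set_option linter.unusedSectionVars false

/-! Put `n = |S||A|`, `H = 1/(1-γ)`, `D = 1/dMin μ`. Each update of `Q` is its stationary mean `α_k
d (TQ - Q)`, where `d = μ` and `T` is the Bellman operator, plus `α_k` times a Markovian noise
`w_k`. From `k₀ = kMix` on, this noise alone is fed into the linear filter `U_{k+1} = (1 - α_k d)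
U_k + α_k w_k`, `U_{k₀} = 0`. The remainder `Z = Q - Q* - U` then contains no noise explicitly:
along every path `‖Z_{k+1}‖ ≤ (1 - α_k dMin (1-γ)) ‖Z_k‖ + α_k dMax ‖U_k‖`
(`supNorm_sub_filteredNoise_succ_le`), because `T` contracts the maximum norm and fixes `Q*`
(`bellman_qStar`).

It remains to bound the second moment of the linear object `U`. Averaging over the next state
removes the martingale part of `w_k`. What is left is a bounded functional of the past times `1{X_k
= y} - d y`. Freezing that functional one mixing time earlier makes the two factors almost
uncorrelated, at a cost of order `τ α_k` (`abs_integral_filteredNoise_mul_noise_le`). Hence `E U²`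
is `O(τ/(k+ξ))`, and the recursion for `E‖Z‖` inherits the rate `√τ/√(k+ξ)`.

The starting error, at most `2H`, contributes `2H √(kMix + ξ)/√(k+ξ)`. Here `kMix ≤ 1 + 2τ`
(`kMix_le`) and `√ξ ≤ c (nHD)³` for `c ≥ 1`. `finite_time_constant_le` compares all constants with
the claimed ones; the second entry of the maximum in `cStar` already suffices. Existence of mixing
constants is Doeblin's theorem, and the asymptotic rate follows from `τ = O(log k)`. -/

namespace QLearning

/-! ### Geometric mixing of finite irreducible aperiodic chains. -/

section StochasticMatrix

variable {ι : Type*} [Fintype ι] {K : Matrix ι ι ℝ} {μ : ι → ℝ}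

lemma IsStationary.le_one (hμ : IsStationary K μ) (y : ι) : μ y ≤ 1 := by
  rw [← hμ.sum_eq_one]
  exact Finset.single_le_sum (fun x _ => hμ.nonneg x) (Finset.mem_univ y)

lemma abs_sub_le_tvDist (p q : ι → ℝ) (y : ι) : |p y - q y| ≤ tvDist p q := by
  have := le_ciSup (f := fun E : Finset ι => |∑ x ∈ E, p x - ∑ x ∈ E, q x|)
    (Set.finite_range _).bddAbove {y}
  simpa [tvDist] using this

lemma tvDist_le_sum_abs (p q : ι → ℝ) : tvDist p q ≤ ∑ x, |p x - q x| := by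
  refine ciSup_le fun E => ?_
  rw [← Finset.sum_sub_distrib]
  exact (Finset.abs_sum_le_sum_abs _ _).trans
    (Finset.sum_le_univ_sum_of_nonneg fun x => abs_nonneg _)

variable [DecidableEq ι]

lemma chain_mem_rowStochastic {S A : Type*} [Fintype S] [Fintype A] [DecidableEq S]
    [DecidableEq A] (M : MDP S A) (β : Policy S A) :
    chain M β ∈ Matrix.rowStochastic ℝ (S × A) := by
  refine Matrix.mem_rowStochastic_iff_sum.2
    ⟨fun x y => mul_nonneg (M.P_nonneg _ _ _) (β.nonneg _ _), fun x => ?_⟩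
  simp only [chain, Fintype.sum_prod_type, ← Finset.mul_sum, β.sum_eq_one, mul_one, M.P_sum]

lemma exists_pow_apply_pos (hK : K ∈ Matrix.rowStochastic ℝ ι) (hirr : K.IsIrreducible) (i j : ι) :
    ∃ k, 0 < (K ^ k) i j := by
  rcases subsingleton_or_nontrivial ι with h | h
  · exact ⟨0, by simp [Subsingleton.elim i j]⟩
  · obtain ⟨k, -, hk⟩ :=
      (Matrix.isIrreducible_iff_exists_pow_pos (fun i j => hK.1 i j)).1 hirr i j
    exact ⟨k, hk⟩

lemma pow_add_apply_pos (hK : K ∈ Matrix.rowStochastic ℝ ι) {a b : ℕ} {i j l : ι}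
    (h₁ : 0 < (K ^ a) i j) (h₂ : 0 < (K ^ b) j l) : 0 < (K ^ (a + b)) i l := by
  rw [pow_add, Matrix.mul_apply]
  exact Finset.sum_pos' (fun y _ => mul_nonneg ((pow_mem hK a).1 _ _) ((pow_mem hK b).1 _ _))
    ⟨j, Finset.mem_univ _, mul_pos h₁ h₂⟩

/-- The powers of an irreducible aperiodic stochastic matrix are eventually positive. -/
lemma exists_forall_pow_apply_pos (hK : K ∈ Matrix.rowStochastic ℝ ι) (hirr : K.IsIrreducible)
    (hap : IsAperiodic K) : ∃ N, ∀ k, N ≤ k → ∀ i j, 0 < (K ^ k) i j := by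
  have hret : ∀ i, ∃ N, ∀ k, N ≤ k → 0 < (K ^ k) i i := by
    intro i
    -- The return times to `i` form an additive submonoid of `ℕ` with gcd one, so they contain all
    -- large integers.
    obtain ⟨N, hN⟩ := Nat.exists_mem_closure_of_ge {k | 0 < (K ^ k) i i}
    have hone : Nat.setGcd {k | 0 < (K ^ k) i i} = 1 :=
      hap i _ fun k hk => Nat.setGcd_dvd_of_mem hk
    refine ⟨N, fun k hk => ?_⟩
    refine AddSubmonoid.closure_induction (motive := fun k _ => 0 < (K ^ k) i i) (fun _ h => h)
      (by simp) (fun a b _ _ ha hb => pow_add_apply_pos hK ha hb) (hN k hk (by simp [hone]))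
  choose N hN using hret
  choose l hl using exists_pow_apply_pos hK hirr
  refine ⟨∑ i, N i + ∑ i, ∑ j, l i j, fun k hk i j => ?_⟩
  have h1 : N i ≤ ∑ i, N i := Finset.single_le_sum (fun _ _ => Nat.zero_le _) (Finset.mem_univ i)
  have h2 : l i j ≤ ∑ j, l i j :=
    Finset.single_le_sum (fun _ _ => Nat.zero_le _) (Finset.mem_univ j)
  have h3 : ∑ j, l i j ≤ ∑ i, ∑ j, l i j :=
    Finset.single_le_sum (f := fun i => ∑ j, l i j) (fun _ _ => Nat.zero_le _) (Finset.mem_univ i)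
  have := pow_add_apply_pos hK (hN i (k - l i j) (by omega)) (hl i j)
  rwa [Nat.sub_add_cancel (by omega)] at this

lemma IsStationary.vecMul_pow (hμ : IsStationary K μ) (k : ℕ) : Matrix.vecMul μ (K ^ k) = μ := by
  induction k with
  | zero => simp
  | succ k ih => rw [pow_succ, ← Matrix.vecMul_vecMul, ih, hμ.invariant]

lemma IsStationary.pos (hK : K ∈ Matrix.rowStochastic ℝ ι) (hirr : K.IsIrreducible)
    (hμ : IsStationary K μ) (y : ι) : 0 < μ y := by
  obtain ⟨x, hx⟩ : ∃ x, 0 < μ x := by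
    by_contra! h
    have := Finset.sum_nonpos (s := Finset.univ) fun x _ => h x
    linarith [hμ.sum_eq_one]
  obtain ⟨k, hk⟩ := exists_pow_apply_pos hK hirr x y
  rw [← hμ.vecMul_pow k]
  exact Finset.sum_pos' (fun z _ => mul_nonneg (hμ.nonneg z) ((pow_mem hK k).1 _ _))
    ⟨x, Finset.mem_univ _, mul_pos hx hk⟩

/-- Doeblin's contraction: a stochastic matrix with all entries at least `ε` contracts the
`ℓ¹`-norm of vectors of total mass zero. -/
lemma sum_abs_vecMul_le {P : Matrix ι ι ℝ} (hP : P ∈ Matrix.rowStochastic ℝ ι) {ε : ℝ}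
    (hε : ∀ i j, ε ≤ P i j) {v : ι → ℝ} (hv : ∑ x, v x = 0) :
    ∑ y, |Matrix.vecMul v P y| ≤ (1 - Fintype.card ι * ε) * ∑ x, |v x| := by
  have h1 : ∀ y, |Matrix.vecMul v P y| ≤ ∑ x, |v x| * (P x y - ε) := by
    intro y
    -- Since `v` has total mass zero, subtracting `ε` from every entry of `P` changes nothing; the
    -- remaining nonnegative rows have sum `1 - card ι * ε`.
    have : Matrix.vecMul v P y = ∑ x, v x * (P x y - ε) := by
      simp only [mul_sub, Finset.sum_sub_distrib, ← Finset.sum_mul, hv, zero_mul, sub_zero]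
      rfl
    rw [this]
    refine (Finset.abs_sum_le_sum_abs _ _).trans (Finset.sum_le_sum fun x _ => ?_)
    rw [abs_mul, abs_of_nonneg (sub_nonneg.2 (hε x y))]
  refine (Finset.sum_le_sum fun y _ => h1 y).trans_eq ?_
  rw [Finset.sum_comm, Finset.mul_sum]
  refine Finset.sum_congr rfl fun x _ => ?_
  rw [← Finset.mul_sum, Finset.sum_sub_distrib, Matrix.sum_row_of_mem_rowStochastic hP]
  simp [mul_comm]

/-- An irreducible aperiodic finite Markov chain mixes geometrically. -/
theorem exists_geometricMixing [Nonempty ι] (hK : K ∈ Matrix.rowStochastic ℝ ι)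
    (hirr : K.IsIrreducible) (hap : IsAperiodic K) (hμ : IsStationary K μ) :
    ∃ m ρ : ℝ, GeometricMixing K μ m ρ := by
  obtain ⟨N₀, hN₀⟩ := exists_forall_pow_apply_pos hK hirr hap
  set N := N₀ + 1
  have hN : ∀ i j, 0 < (K ^ N) i j := hN₀ N (by omega)
  obtain ⟨p, hp⟩ := Finite.exists_min fun p : ι × ι => (K ^ N) p.1 p.2
  set ε := (K ^ N) p.1 p.2
  have hε : ∀ i j, ε ≤ (K ^ N) i j := fun i j => hp (i, j)
  have hε0 : 0 < ε := hN _ _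
  have hn : (1 : ℝ) ≤ Fintype.card ι := by exact_mod_cast Fintype.card_pos
  -- The maximum with `1/2` keeps the rate positive when `card ι * ε = 1`.
  set ρ₁ := max (1 - Fintype.card ι * ε) (1 / 2)
  have hρ₁0 : 0 < ρ₁ := lt_max_of_lt_right (by norm_num)
  have hρ₁1 : ρ₁ < 1 := max_lt (by nlinarith) (by norm_num)
  have hsum : ∀ x k, ∑ y, ((K ^ k) x y - μ y) = 0 := by
    intro x k
    rw [Finset.sum_sub_distrib, Matrix.sum_row_of_mem_rowStochastic (pow_mem hK k),
      hμ.sum_eq_one, sub_self]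
  have hstep : ∀ x k l, (fun y => (K ^ (k + l)) x y - μ y)
      = Matrix.vecMul (fun y => (K ^ k) x y - μ y) (K ^ l) := by
    intro x k l
    funext y
    have : Matrix.vecMul (fun y => (K ^ k) x y - μ y) (K ^ l)
        = Matrix.vecMul ((K ^ k) x) (K ^ l) - Matrix.vecMul μ (K ^ l) := by
      rw [← Matrix.sub_vecMul]; rfl
    rw [this, hμ.vecMul_pow, pow_add, Matrix.mul_apply]
    rfl
  have hblock : ∀ x q, ∑ y, |(K ^ (N * q)) x y - μ y| ≤ 2 * ρ₁ ^ q := by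
    intro x q
    induction q with
    | zero =>
      refine (Finset.sum_le_sum fun y _ => abs_sub _ _).trans ?_
      simp only [abs_of_nonneg ((pow_mem hK (N * 0)).1 _ _), abs_of_nonneg (hμ.nonneg _),
        Finset.sum_add_distrib, hμ.sum_eq_one,
        Matrix.sum_row_of_mem_rowStochastic (pow_mem hK (N * 0))]
      norm_num
    | succ q ih =>
      have h := sum_abs_vecMul_le (pow_mem hK N) hε (hsum x (N * q))
      rw [← hstep, ← Nat.mul_succ] at h
      refine h.trans ?_
      calc _ ≤ ρ₁ * ∑ y, |(K ^ (N * q)) x y - μ y| :=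
            mul_le_mul_of_nonneg_right (le_max_left _ _)
              (Finset.sum_nonneg fun _ _ => abs_nonneg _)
        _ ≤ ρ₁ * (2 * ρ₁ ^ q) := mul_le_mul_of_nonneg_left ih hρ₁0.le
        _ = 2 * ρ₁ ^ (q + 1) := by ring
  have hall : ∀ x q r, ∑ y, |(K ^ (N * q + r)) x y - μ y| ≤ 2 * ρ₁ ^ q := by
    intro x q r
    -- The contraction estimate with `ε = 0`: the `r` leftover steps do not increase the `ℓ¹`
    -- distance.
    have h := sum_abs_vecMul_le (pow_mem hK r) (fun i j => (pow_mem hK r).1 i j) (hsum x (N * q))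
    rw [← hstep] at h
    simpa using h.trans (by simpa using hblock x q)
  have hNpos : (0 : ℝ) < N := by positivity
  set ρ := ρ₁ ^ (1 / (N : ℝ))
  have hρN : ρ ^ N = ρ₁ := by
    rw [← Real.rpow_natCast, ← Real.rpow_mul hρ₁0.le, one_div_mul_cancel hNpos.ne', Real.rpow_one]
  have hρ0 : 0 < ρ := Real.rpow_pos_of_pos hρ₁0 _
  have hρ1 : ρ < 1 := Real.rpow_lt_one hρ₁0.le hρ₁1 (by positivity)
  -- Dividing by `ρ₁` pays for the incomplete last block: `ρ₁ ^ (k / N) ≤ ρ ^ k / ρ₁`.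
  refine ⟨2 / ρ₁, ρ, by positivity, hρ0, hρ1, fun k x => (tvDist_le_sum_abs _ _).trans ?_⟩
  have hk := hall x (k / N) (k % N)
  rw [Nat.div_add_mod] at hk
  refine hk.trans ?_
  have h1 : ρ₁ ^ (k / N) * ρ₁ = ρ ^ (N * (k / N) + N) := by
    rw [pow_add, pow_mul, hρN]
  have h2 : ρ ^ (N * (k / N) + N) ≤ ρ ^ k := by
    refine pow_le_pow_of_le_one hρ0.le hρ1.le ?_
    have := Nat.div_add_mod k N
    have := Nat.mod_lt k (show 0 < N by omega)
    omega
  rw [div_mul_eq_mul_div, le_div_iff₀ hρ₁0, mul_assoc, h1]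
  linarith

lemma GeometricMixing.abs_pow_sub_le {m ρ : ℝ} (h : GeometricMixing K μ m ρ) (k : ℕ) (x y : ι) :
    |(K ^ k) x y - μ y| ≤ m * ρ ^ k :=
  (abs_sub_le_tvDist (fun y => (K ^ k) x y) μ y).trans (h.bound k x)

end StochasticMatrix

/-! ### Elementary estimates for suprema and the maximum norm. -/

section SupNorm

variable {ι : Type*}

lemma supNorm_le [Nonempty ι] {v : ι → ℝ} {b : ℝ} (h : ∀ x, |v x| ≤ b) : supNorm v ≤ b :=
  ciSup_le h

lemma supNorm_nonneg (v : ι → ℝ) : 0 ≤ supNorm v :=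
  Real.iSup_nonneg fun _ => abs_nonneg _

variable [Finite ι]

lemma abs_le_supNorm (v : ι → ℝ) (x : ι) : |v x| ≤ supNorm v :=
  le_ciSup (f := fun x => |v x|) (Set.finite_range _).bddAbove x

lemma supNorm_add_le [Nonempty ι] (v w : ι → ℝ) : supNorm (v + w) ≤ supNorm v + supNorm w :=
  supNorm_le fun x => (abs_add_le _ _).trans (add_le_add (abs_le_supNorm v x) (abs_le_supNorm w x))

lemma iSup_le_iSup_add [Nonempty ι] {f g : ι → ℝ} {b : ℝ} (h : ∀ x, f x ≤ g x + b) :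
    ⨆ x, f x ≤ (⨆ x, g x) + b :=
  ciSup_le fun x => (h x).trans
    (add_le_add_left (le_ciSup (Set.finite_range g).bddAbove x) b)

lemma abs_iSup_sub_iSup_le [Nonempty ι] {f g : ι → ℝ} {b : ℝ} (h : ∀ x, |f x - g x| ≤ b) :
    |(⨆ x, f x) - ⨆ x, g x| ≤ b := by
  have h1 := iSup_le_iSup_add (f := f) (g := g) (b := b)
    fun x => by linarith [(abs_le.1 (h x)).2]
  have h2 := iSup_le_iSup_add (f := g) (g := f) (b := b)
    fun x => by linarith [(abs_le.1 (h x)).1]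
  exact abs_le.2 ⟨by linarith, by linarith⟩

lemma abs_iSup_le [Nonempty ι] {f : ι → ℝ} {b : ℝ} (h : ∀ x, |f x| ≤ b) : |⨆ x, f x| ≤ b := by
  simpa using abs_iSup_sub_iSup_le (f := f) (g := fun _ => 0) (b := b) (by simpa using h)

end SupNorm

/-! ### The Bellman operator and its fixed point `qStar`. -/

section Bellman

variable {S A : Type*} [Fintype S]

lemma MDP.sum_mul_le (M : MDP S A) (x : S × A) {f : S → ℝ} {b : ℝ} (h : ∀ s, f s ≤ b) :
    ∑ s, M.P x.1 x.2 s * f s ≤ b := by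
  calc _ ≤ ∑ s, M.P x.1 x.2 s * b :=
        Finset.sum_le_sum fun s _ => mul_le_mul_of_nonneg_left (h s) (M.P_nonneg _ _ _)
    _ = b := by rw [← Finset.sum_mul, M.P_sum, one_mul]

lemma MDP.abs_sum_mul_le (M : MDP S A) (x : S × A) {f : S → ℝ} {b : ℝ} (h : ∀ s, |f s| ≤ b) :
    |∑ s, M.P x.1 x.2 s * f s| ≤ b := by
  refine abs_le'.2 ⟨M.sum_mul_le x fun s => (le_abs_self _).trans (h s), ?_⟩
  rw [← Finset.sum_neg_distrib]
  simpa only [mul_neg] using M.sum_mul_le x (f := fun s => -f s)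
    fun s => (neg_le_abs _).trans (h s)

lemma mulVec_detKernel [Fintype A] [DecidableEq A] (M : MDP S A) (π : S → A) (f : S × A → ℝ) (x : S × A) :
    (detKernel M π).mulVec f x = ∑ s, M.P x.1 x.2 s * f (s, π s) := by
  simp [Matrix.mulVec, dotProduct, detKernel, Fintype.sum_prod_type]

lemma abs_pow_detKernel_mulVec_le [Fintype A] [DecidableEq S] [DecidableEq A]
    (M : MDP S A) (π : S → A) {f : S × A → ℝ} {b : ℝ} (h : ∀ x, |f x| ≤ b)
    (k : ℕ) (x : S × A) : |(detKernel M π ^ k).mulVec f x| ≤ b := by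
  induction k generalizing x with
  | zero => simpa using h x
  | succ k ih =>
    rw [pow_succ', ← Matrix.mulVec_mulVec, mulVec_detKernel]
    exact M.abs_sum_mul_le x fun s => ih _

/-- Splitting off the term `k = 0` of the discounted series gives the policy evaluation equation;
the series is dominated by a geometric one. -/
lemma qPolicy_eq [Fintype A] [DecidableEq S] [DecidableEq A] (M : MDP S A)
    (π : S → A) (x : S × A) :
    qPolicy M π x
      = ∑ s, M.P x.1 x.2 s * (M.r x.1 x.2 s + M.γ * qPolicy M π (s, π s)) := by
  have hs : ∀ y, Summable fun k => M.γ ^ k * (detKernel M π ^ k).mulVec (expReward M) y := by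
    intro y
    refine Summable.of_norm_bounded
      ((summable_geometric_of_lt_one M.γ_nonneg M.γ_lt_one).mul_right (supNorm (expReward M)))
      fun k => ?_
    rw [norm_mul, norm_pow, Real.norm_of_nonneg M.γ_nonneg]
    exact mul_le_mul_of_nonneg_left
      (abs_pow_detKernel_mulVec_le M π (abs_le_supNorm _) k y) (pow_nonneg M.γ_nonneg _)
  have hterm : ∀ k, M.γ ^ (k + 1) * (detKernel M π ^ (k + 1)).mulVec (expReward M) x
      = ∑ s, M.P x.1 x.2 s * M.γ
        * (M.γ ^ k * (detKernel M π ^ k).mulVec (expReward M) (s, π s)) := by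
    intro k
    rw [pow_succ' (detKernel M π), ← Matrix.mulVec_mulVec, mulVec_detKernel, Finset.mul_sum]
    exact Finset.sum_congr rfl fun s _ => by ring
  rw [qPolicy, (hs x).tsum_eq_zero_add]
  simp only [hterm]
  rw [Summable.tsum_finsetSum fun s _ => (hs _).mul_left _]
  simp only [tsum_mul_left, mul_add, Finset.sum_add_distrib]
  congr 1
  · simp [expReward]
  · exact Finset.sum_congr rfl fun s _ => by rw [mul_assoc]; rfl

/-- The Bellman optimality operator. -/
noncomputable def bellman (M : MDP S A) (Q : S × A → ℝ) (x : S × A) : ℝ :=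
  ∑ s, M.P x.1 x.2 s * (M.r x.1 x.2 s + M.γ * ⨆ u, Q (s, u))

variable [Fintype A] [Nonempty A]

lemma bellman_le_add (M : MDP S A) {Q Q' : S × A → ℝ} {b : ℝ} (h : ∀ x, Q x ≤ Q' x + b)
    (x : S × A) : bellman M Q x ≤ bellman M Q' x + M.γ * b := by
  rw [← sub_le_iff_le_add', bellman, bellman, ← Finset.sum_sub_distrib]
  simp only [← mul_sub]
  refine M.sum_mul_le x fun s => ?_
  have := mul_le_mul_of_nonneg_left
    (iSup_le_iSup_add (f := fun u => Q (s, u)) (g := fun u => Q' (s, u)) fun u => h (s, u))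
    M.γ_nonneg
  linarith

lemma abs_bellman_sub_le (M : MDP S A) {Q Q' : S × A → ℝ} {b : ℝ} (h : ∀ x, |Q x - Q' x| ≤ b)
    (x : S × A) : |bellman M Q x - bellman M Q' x| ≤ M.γ * b := by
  have h1 := bellman_le_add M (Q := Q) (Q' := Q') (b := b)
    (fun x => by linarith [(abs_le.1 (h x)).2]) x
  have h2 := bellman_le_add M (Q := Q') (Q' := Q) (b := b)
    (fun x => by linarith [(abs_le.1 (h x)).1]) x
  exact abs_le.2 ⟨by linarith, by linarith⟩

lemma abs_bellman_le (M : MDP S A) (hr : ∀ s a s', |M.r s a s'| ≤ 1) {Q : S × A → ℝ} {b : ℝ}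
    (h : ∀ x, |Q x| ≤ b) (x : S × A) : |bellman M Q x| ≤ 1 + M.γ * b := by
  refine M.abs_sum_mul_le x fun s => (abs_add_le _ _).trans (add_le_add (hr _ _ _) ?_)
  rw [abs_mul, abs_of_nonneg M.γ_nonneg]
  exact mul_le_mul_of_nonneg_left (abs_iSup_le fun u => h (s, u)) M.γ_nonneg

lemma exists_bellman_eq (M : MDP S A) : ∃ Q, bellman M Q = Q := by
  have hc : ContractingWith ⟨M.γ, M.γ_nonneg⟩ (bellman M) := by
    refine ⟨by exact_mod_cast M.γ_lt_one, LipschitzWith.of_dist_le_mul fun Q Q' => ?_⟩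
    refine (dist_pi_le_iff (mul_nonneg M.γ_nonneg dist_nonneg)).2 fun x => ?_
    exact abs_bellman_sub_le M (fun y => dist_le_pi_dist Q Q' y) x
  exact ⟨_, hc.fixedPoint_isFixedPt⟩

/-- A function whose upper bounds can be improved by a factor `c < 1` is nonpositive. -/
lemma nonpos_of_forall_le_mul {ι : Type*} [Finite ι] {d : ι → ℝ} {c : ℝ} (hc : c < 1)
    (h : ∀ b, 0 ≤ b → (∀ y, d y ≤ b) → ∀ x, d x ≤ c * b) (x : ι) : d x ≤ 0 := by
  have : Nonempty ι := ⟨x⟩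
  obtain ⟨y, hy⟩ := Finite.exists_max d
  refine (hy x).trans ?_
  by_contra! hpos
  have := h (d y) hpos.le hy y
  nlinarith

variable [DecidableEq S] [DecidableEq A]

/-- The optimal Q-function solves the Bellman optimality equation. -/
theorem bellman_qStar (M : MDP S A) : bellman M (qStar M) = qStar M := by
  obtain ⟨Q, hQ⟩ := exists_bellman_eq M
  -- `π` is a greedy policy for the fixed point `Q`. Every policy value lies below `Q`, and the
  -- value of `π` attains it; in both cases the gap satisfies a `γ`-contraction.
  choose π hπ using fun s => exists_eq_ciSup_of_finite (f := fun u => Q (s, u))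
  suffices qStar M = Q by rw [this, hQ]
  funext x
  refine le_antisymm (ciSup_le fun π' => ?_) ?_
  · refine sub_nonpos.1 (nonpos_of_forall_le_mul (d := fun x => qPolicy M π' x - Q x)
      M.γ_lt_one (fun b _ hb y => ?_) x)
    have h1 : qPolicy M π' y ≤ bellman M (qPolicy M π') y := by
      rw [qPolicy_eq]
      refine Finset.sum_le_sum fun s _ => mul_le_mul_of_nonneg_left
        (add_le_add_right (mul_le_mul_of_nonneg_left ?_ M.γ_nonneg) _) (M.P_nonneg _ _ _)
      exact le_ciSup (f := fun u => qPolicy M π' (s, u)) (Set.finite_range _).bddAbove _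
    have h2 := bellman_le_add M (Q := qPolicy M π') (Q' := Q) (b := b)
      (fun z => by linarith [hb z]) y
    rw [hQ] at h2
    linarith
  · refine le_trans ?_ (le_ciSup (f := fun π => qPolicy M π x) (Set.finite_range _).bddAbove π)
    refine sub_nonpos.1 (nonpos_of_forall_le_mul (d := fun x => Q x - qPolicy M π x)
      M.γ_lt_one (fun b _ hb y => ?_) x)
    have h1 : Q y = ∑ s, M.P y.1 y.2 s * (M.r y.1 y.2 s + M.γ * Q (s, π s)) := by
      conv_lhs => rw [← hQ]
      simp only [bellman, hπ]
    rw [h1, qPolicy_eq, ← Finset.sum_sub_distrib]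
    simp only [← mul_sub]
    refine M.sum_mul_le y fun s => ?_
    have := mul_le_mul_of_nonneg_left (hb (s, π s)) M.γ_nonneg
    linarith

lemma abs_qStar_le (M : MDP S A) (hr : ∀ s a s', |M.r s a s'| ≤ 1) (x : S × A) :
    |qStar M x| ≤ 1 / (1 - M.γ) := by
  have hγ : 0 < 1 - M.γ := sub_pos.2 M.γ_lt_one
  have : Nonempty (S × A) := ⟨x⟩
  have h : supNorm (qStar M) ≤ 1 + M.γ * supNorm (qStar M) := by
    refine supNorm_le fun y => ?_
    rw [← bellman_qStar]
    exact (abs_bellman_le M hr (abs_le_supNorm _) y).trans_eq (by rw [bellman_qStar])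
  refine (abs_le_supNorm _ x).trans ?_
  rw [le_div_iff₀ hγ]
  linarith

end Bellman

/-! ### The Markov property for functionals of finitely many states. -/

section MarkovChain

variable {ι Ω : Type*} [MeasurableSpace Ω] {ℙ : Measure Ω} {K : Matrix ι ι ℝ} {X : ℕ → Ω → ι}

/-- The event that the path `X` agrees with `x` up to time `k`. -/
def cylinder (X : ℕ → Ω → ι) (k : ℕ) (x : ℕ → ι) : Set Ω := {ω | ∀ i ≤ k, X i ω = x i}

/-- The path which follows `p` and then stays in its initial point. -/
def extendPath {k : ℕ} (p : Fin (k + 1) → ι) (i : ℕ) : ι :=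
  if h : i < k + 1 then p ⟨i, h⟩ else p 0

lemma measurableSet_cylinder (hX : IsMarkovChain ℙ K X) (k : ℕ) (x : ℕ → ι) :
    MeasurableSet (cylinder X k x) := by
  have : cylinder X k x = ⋂ i ∈ Set.Iic k, {ω | X i ω = x i} := by
    ext; simp [cylinder]
  rw [this]
  exact MeasurableSet.biInter (Set.to_countable _) fun i _ => hX.meas i _

variable [Fintype ι] [IsProbabilityMeasure ℙ]

/-- A functional of the states up to time `k` takes finitely many values, one per path. The
hypotheses on `E` say that `E p` is the cylinder of `p` intersected with `B`; this allows an event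
about the next state to be carried along. -/
lemma mul_indicator_eq_sum {f : (ℕ → ι) → ℝ} {k : ℕ} (hf : DependsOn f (Set.Iic k))
    (E : (ℕ → ι) → Set Ω)
    (hE : ∀ ω, ∀ p : Fin (k + 1) → ι, ω ∈ E (extendPath p) → ω ∈ cylinder X k (extendPath p))
    {B : Set Ω} (hB : ∀ ω, ∀ p : Fin (k + 1) → ι, ω ∈ cylinder X k (extendPath p) →
      (ω ∈ E (extendPath p) ↔ ω ∈ B)) (ω : Ω) :
    f (fun i => X i ω) * B.indicator 1 ω
      = ∑ p : Fin (k + 1) → ι, f (extendPath p) * (E (extendPath p)).indicator 1 ω := by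
  classical
  have hmem : ω ∈ cylinder X k (extendPath fun i : Fin (k + 1) => X i ω) := by
    intro i hi
    simp [extendPath, Nat.lt_succ_of_le hi]
  rw [Finset.sum_eq_single fun i : Fin (k + 1) => X i ω]
  · rw [hf (y := extendPath fun i : Fin (k + 1) => X i ω) fun i hi => hmem i hi]
    congr 1
    by_cases h : ω ∈ B
    · simp [h, (hB ω _ hmem).2 h]
    · simp [h, mt (hB ω _ hmem).1 h]
  · intro p _ hp
    rw [Set.indicator_of_notMem, mul_zero]
    intro h
    refine hp (funext fun i => ?_)
    have := hE ω p h i (Nat.le_of_lt_succ i.2)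
    simpa [extendPath, Nat.le_of_lt_succ i.2] using this.symm
  · simp

lemma eq_sum_indicator {f : (ℕ → ι) → ℝ} {k : ℕ} (hf : DependsOn f (Set.Iic k)) (ω : Ω) :
    f (fun i => X i ω)
      = ∑ p : Fin (k + 1) → ι, f (extendPath p) * (cylinder X k (extendPath p)).indicator 1 ω := by
  have := mul_indicator_eq_sum (X := X) hf (cylinder X k) (fun _ _ h => h) (B := Set.univ)
    (fun _ _ h => by simp [h]) ω
  simpa using this

/-- The functional is a finite linear combination of indicators of measurable cylinders. -/
lemma IsMarkovChain.integrable (hX : IsMarkovChain ℙ K X) {f : (ℕ → ι) → ℝ} {k : ℕ}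
    (hf : DependsOn f (Set.Iic k)) : Integrable (fun ω => f (fun i => X i ω)) ℙ := by
  simp only [eq_sum_indicator (X := X) hf]
  exact integrable_finsetSum _ fun p _ =>
    ((integrable_const (1 : ℝ)).indicator (measurableSet_cylinder hX k _)).const_mul _

lemma integral_sum_mul_indicator {κ : Type*} [Fintype κ] (c : κ → ℝ) {E : κ → Set Ω}
    (hE : ∀ p, MeasurableSet (E p)) :
    ∫ ω, ∑ p, c p * (E p).indicator 1 ω ∂ℙ = ∑ p, c p * ℙ.real (E p) := by
  have h := integral_finsetSum (μ := ℙ) Finset.univ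
    (f := fun p ω => c p * (E p).indicator (1 : Ω → ℝ) ω) fun p _ =>
      ((integrable_const (1 : ℝ)).indicator (hE p)).const_mul _
  rw [h]
  exact Finset.sum_congr rfl fun p _ => by
    rw [integral_const_mul, integral_indicator_one (hE p)]

/-- The Markov property for the next state being `y`. -/
lemma IsMarkovChain.integral_mul_indicator (hX : IsMarkovChain ℙ K X) {f : (ℕ → ι) → ℝ} {k : ℕ}
    (hf : DependsOn f (Set.Iic k)) (y : ι) :
    ∫ ω, f (fun i => X i ω) * {ω | X (k + 1) ω = y}.indicator 1 ω ∂ℙ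
      = ∫ ω, K (X k ω) y * f (fun i => X i ω) ∂ℙ := by
  classical
  -- Prescribing `y` at time `k + 1` turns the event into a cylinder of length `k + 1`, to which the
  -- defining identity `step` applies.
  have hcyl : ∀ x : ℕ → ι, cylinder X (k + 1) (Function.update x (k + 1) y)
      = cylinder X k x ∩ {ω | X (k + 1) ω = y} := by
    intro x
    ext ω
    constructor
    · intro h
      refine ⟨fun i hi => ?_, by simpa using h (k + 1) le_rfl⟩
      have := h i (by omega)
      rwa [Function.update_of_ne (by omega)] at this
    · rintro ⟨h, h'⟩ i hi
      rcases Nat.le_succ_iff.1 hi with hi | rfl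
      · rw [Function.update_of_ne (by omega)]; exact h i hi
      · simpa using h'
  have hg : DependsOn (fun x : ℕ → ι => K (x k) y * f x) (Set.Iic k) := by
    intro x x' h
    simp only [h k Set.self_mem_Iic, hf h]
  have h1 := mul_indicator_eq_sum (X := X) hf
    (fun x => cylinder X (k + 1) (Function.update x (k + 1) y))
    (fun ω p h => by rw [hcyl] at h; exact h.1) (B := {ω | X (k + 1) ω = y})
    (fun ω p h => by simp [hcyl, h])
  simp only [h1]
  have h2 := eq_sum_indicator (X := X) hg
  simp only at h2
  simp only [h2]
  rw [integral_sum_mul_indicator _ fun p => measurableSet_cylinder hX _ _,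
    integral_sum_mul_indicator _ fun p => measurableSet_cylinder hX _ _]
  refine Finset.sum_congr rfl fun p _ => ?_
  have h3 := hX.step k (Function.update (extendPath p) (k + 1) y)
  have h4 : cylinder X k (Function.update (extendPath p) (k + 1) y)
      = cylinder X k (extendPath p) := by
    ext ω
    refine forall₂_congr fun i hi => ?_
    rw [Function.update_of_ne (by omega)]
  change ℙ.real (cylinder X (k + 1) _) = ℙ.real (cylinder X k _) * _ at h3
  rw [h3, h4, Function.update_of_ne (by omega), Function.update_self]
  ring

/-- The Markov property: the next state may be averaged out. -/
lemma IsMarkovChain.integral_next (hX : IsMarkovChain ℙ K X) {F : (ℕ → ι) → ι → ℝ} {k : ℕ}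
    (hF : ∀ y, DependsOn (fun x => F x y) (Set.Iic k)) :
    ∫ ω, F (fun i => X i ω) (X (k + 1) ω) ∂ℙ
      = ∫ ω, ∑ y, K (X k ω) y * F (fun i => X i ω) y ∂ℙ := by
  classical
  have h1 : ∀ ω, F (fun i => X i ω) (X (k + 1) ω)
      = ∑ y, F (fun i => X i ω) y * {ω | X (k + 1) ω = y}.indicator 1 ω := by
    intro ω
    simp [Set.indicator_apply]
  have hK : ∀ y, DependsOn (fun x : ℕ → ι => K (x k) y * F x y) (Set.Iic k) := by
    intro y x x' h
    have := hF y h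
    simp only at this
    simp only [h k Set.self_mem_Iic, this]
  simp only [h1]
  rw [integral_finsetSum, integral_finsetSum]
  · exact Finset.sum_congr rfl fun y _ => hX.integral_mul_indicator (hF y) y
  · exact fun y _ => hX.integrable (hK y)
  · intro y _
    have := (hX.integrable (hF y)).indicator (hX.meas (k + 1) y)
    refine this.congr (Filter.Eventually.of_forall fun ω => ?_)
    simp only [Set.indicator_apply, Pi.one_apply, mul_ite, mul_one, mul_zero]

variable [DecidableEq ι]

/-- The last step is averaged out repeatedly, each time replacing `g` by `K.mulVec g`. -/
lemma IsMarkovChain.integral_mul_pow (hX : IsMarkovChain ℙ K X) {f : (ℕ → ι) → ℝ} {k : ℕ}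
    (hf : DependsOn f (Set.Iic k)) (t : ℕ) (g : ι → ℝ) :
    ∫ ω, f (fun i => X i ω) * g (X (k + t) ω) ∂ℙ
      = ∫ ω, f (fun i => X i ω) * (K ^ t).mulVec g (X k ω) ∂ℙ := by
  induction t generalizing g with
  | zero => simp
  | succ t ih =>
    rw [pow_succ, ← Matrix.mulVec_mulVec, ← ih, ← add_assoc,
      hX.integral_next (k := k + t) (F := fun x y => f x * g y) fun y x x' h => by
        simp only [hf fun i hi => h i ((Set.mem_Iic.1 hi).trans (Nat.le_add_right k t))]]
    refine integral_congr_ae (Filter.Eventually.of_forall fun ω => ?_)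
    simp only [Matrix.mulVec, dotProduct, Finset.mul_sum]
    exact Finset.sum_congr rfl fun y _ => by ring

/-- Functionals of the past are almost uncorrelated with the state after a mixing time. -/
lemma IsMarkovChain.abs_integral_mul_sub_le (hX : IsMarkovChain ℙ K X)
    (hK : K ∈ Matrix.rowStochastic ℝ ι) {f : (ℕ → ι) → ℝ} {k : ℕ}
    (hf : DependsOn f (Set.Iic k)) {b e d : ℝ} (hb : ∀ x, |f x| ≤ b) {t : ℕ} {y : ι}
    (he : ∀ x, |(K ^ t) x y - d| ≤ e) :
    |∫ ω, f (fun i => X i ω) * ((if X (k + t) ω = y then 1 else 0) - d) ∂ℙ| ≤ b * e := by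
  rw [hX.integral_mul_pow hf t fun x => (if x = y then 1 else 0) - d]
  have h : ∀ x, (K ^ t).mulVec (fun x => (if x = y then (1 : ℝ) else 0) - d) x
      = (K ^ t) x y - d := by
    intro x
    simp only [Matrix.mulVec, dotProduct, mul_sub, Finset.sum_sub_distrib, ← Finset.sum_mul,
      Matrix.sum_row_of_mem_rowStochastic (pow_mem hK t)]
    simp
  simp only [h]
  have := norm_integral_le_of_norm_le_const (μ := ℙ) (C := b * e)
    (f := fun ω => f (fun i => X i ω) * ((K ^ t) (X k ω) y - d))
    (Filter.Eventually.of_forall fun ω => by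
      rw [norm_mul]
      exact mul_le_mul (hb _) (he _) (abs_nonneg _)
        ((abs_nonneg _).trans (hb fun i => X i ω)))
  simpa using this

end MarkovChain

/-! ### Estimates along a single path: bounds on iterates, noise and filter. -/

section Paths

variable {S A : Type*} [Fintype S]

/-- The temporal-difference error at the pair `y` when the next state is `s'`. -/
noncomputable def tdError (M : MDP S A) (Q : S × A → ℝ) (y : S × A) (s' : S) : ℝ :=
  M.r y.1 y.2 s' + M.γ * (⨆ u : A, Q (s', u)) - Q y

/-- The expected temporal-difference error. -/
noncomputable def drift (M : MDP S A) (Q : S × A → ℝ) (y : S × A) : ℝ := bellman M Q y - Q y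

/-- This identity is why averaging over the next state removes the martingale part of the noise. -/
lemma sum_mul_tdError (M : MDP S A) (Q : S × A → ℝ) (y : S × A) :
    ∑ s, M.P y.1 y.2 s * tdError M Q y s = drift M Q y := by
  simp only [tdError, drift, bellman, mul_sub, Finset.sum_sub_distrib, ← Finset.sum_mul, M.P_sum,
    one_mul]

lemma abs_drift_sub_le [Fintype A] [Nonempty A] {M : MDP S A} {Q Q' : S × A → ℝ} {b : ℝ}
    (h : ∀ y, |Q y - Q' y| ≤ b) (y : S × A) :
    |drift M Q y - drift M Q' y| ≤ 2 * b := by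
  have h1 := abs_le.1 (abs_bellman_sub_le M h y)
  have h2 := abs_le.1 (h y)
  have hb : 0 ≤ b := (abs_nonneg _).trans (h y)
  have hγ : M.γ * b ≤ b := mul_le_of_le_one_left hb M.γ_lt_one.le
  simp only [drift]
  exact abs_le.2 ⟨by linarith, by linarith⟩

lemma MDP.one_le_horizon (M : MDP S A) : 1 ≤ 1 / (1 - M.γ) := by
  rw [le_div_iff₀ (sub_pos.2 M.γ_lt_one)]
  linarith [M.γ_nonneg]

lemma MDP.one_add_mul_horizon (M : MDP S A) : 1 + M.γ * (1 / (1 - M.γ)) = 1 / (1 - M.γ) := by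
  have : 1 - M.γ ≠ 0 := (sub_pos.2 M.γ_lt_one).ne'
  field_simp
  ring

variable [DecidableEq S] [DecidableEq A]

/-- The deviation of the observed update from its stationary mean, at the pair `y`, when the
observed transition is from the pair `z` to the state `s'`. -/
noncomputable def noise (M : MDP S A) (d : S × A → ℝ) (Q : S × A → ℝ) (y z : S × A) (s' : S) : ℝ :=
  (if y = z then tdError M Q y s' else 0) - d y * drift M Q y

/-- The noise from time `k₀` on, passed through the linear filter with rates `αₖ d`. -/
noncomputable def filteredNoise (M : MDP S A) (α : ℕ → ℝ) (Q₀ d : S × A → ℝ) (k₀ : ℕ)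
    (x : ℕ → S × A) : ℕ → S × A → ℝ
  | 0 => 0
  | k + 1 => fun y => (1 - α k * d y) * filteredNoise M α Q₀ d k₀ x k y
      + α k * if k₀ ≤ k then noise M d (qIter M α Q₀ x k) y (x k) (x (k + 1)).1 else 0

variable {M : MDP S A} {α : ℕ → ℝ} {Q₀ d : S × A → ℝ} {k₀ : ℕ} {x : ℕ → S × A}

lemma qIter_succ (k : ℕ) (y : S × A) : qIter M α Q₀ x (k + 1) y = qIter M α Q₀ x k y
    + if y = x k then α k * tdError M (qIter M α Q₀ x k) y (x (k + 1)).1 else 0 := by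
  by_cases h : y = x k
  · simp only [qIter, tdError, h, if_true]
  · simp only [qIter, h, if_false, add_zero]

/-- The update made at time `k` looks at the state at time `k + 1`, so `Q_{k+1}` depends on the path
up to and including time `k + 1`. -/
lemma dependsOn_qIter (k : ℕ) : DependsOn (fun x => qIter M α Q₀ x k) (Set.Iic k) := by
  induction k with
  | zero => intro x x' _; rfl
  | succ k ih =>
    intro x x' h
    have h1 : qIter M α Q₀ x k = qIter M α Q₀ x' k :=
      ih fun i hi => h i (Nat.le_succ_of_le hi)
    funext y
    simp only [qIter_succ, h1, h k (Nat.le_succ k), h (k + 1) Set.self_mem_Iic]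

lemma dependsOn_filteredNoise (k : ℕ) :
    DependsOn (fun x => filteredNoise M α Q₀ d k₀ x k) (Set.Iic k) := by
  induction k with
  | zero => intro x x' _; rfl
  | succ k ih =>
    intro x x' h
    have h1 : filteredNoise M α Q₀ d k₀ x k = filteredNoise M α Q₀ d k₀ x' k :=
      ih fun i hi => h i (Nat.le_succ_of_le hi)
    have h2 : qIter M α Q₀ x k = qIter M α Q₀ x' k :=
      dependsOn_qIter k fun i hi => h i (Nat.le_succ_of_le hi)
    funext y
    simp only [filteredNoise, h1, h2, h k (Nat.le_succ k), h (k + 1) Set.self_mem_Iic]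

/-- The filter starts from zero at `k₀`, so the second-moment recursion has no initial term and the
remainder there is just `Q - Q*`. -/
lemma filteredNoise_eq_zero {k : ℕ} (hk : k ≤ k₀) : filteredNoise M α Q₀ d k₀ x k = 0 := by
  induction k with
  | zero => rfl
  | succ k ih =>
    funext y
    simp [filteredNoise, ih (by omega), show ¬ k₀ ≤ k by omega]

variable [Fintype A] [Nonempty A]

lemma abs_tdError_add_le (hr : ∀ s a s', |M.r s a s'| ≤ 1) {Q : S × A → ℝ}
    (hQ : ∀ y, |Q y| ≤ 1 / (1 - M.γ)) (y : S × A) (s' : S) :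
    |tdError M Q y s' + Q y| ≤ 1 / (1 - M.γ) := by
  rw [tdError, sub_add_cancel, ← M.one_add_mul_horizon]
  refine (abs_add_le _ _).trans (add_le_add (hr _ _ _) ?_)
  rw [abs_mul, abs_of_nonneg M.γ_nonneg]
  exact mul_le_mul_of_nonneg_left (abs_iSup_le fun u => hQ _) M.γ_nonneg

lemma abs_tdError_le (hr : ∀ s a s', |M.r s a s'| ≤ 1) {Q : S × A → ℝ}
    (hQ : ∀ y, |Q y| ≤ 1 / (1 - M.γ)) (y : S × A) (s' : S) :
    |tdError M Q y s'| ≤ 2 * (1 / (1 - M.γ)) := by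
  have h1 := abs_le.1 (abs_tdError_add_le hr hQ y s')
  have h2 := abs_le.1 (hQ y)
  exact abs_le.2 ⟨by linarith, by linarith⟩

lemma abs_drift_le (hr : ∀ s a s', |M.r s a s'| ≤ 1) {Q : S × A → ℝ}
    (hQ : ∀ y, |Q y| ≤ 1 / (1 - M.γ)) (y : S × A) :
    |drift M Q y| ≤ 2 * (1 / (1 - M.γ)) := by
  rw [← sum_mul_tdError]
  exact M.abs_sum_mul_le y (abs_tdError_le hr hQ y)

lemma abs_noise_le (hr : ∀ s a s', |M.r s a s'| ≤ 1) {Q : S × A → ℝ}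
    (hQ : ∀ y, |Q y| ≤ 1 / (1 - M.γ)) {y : S × A} (hd : 0 ≤ d y) (hd1 : d y ≤ 1)
    (z : S × A) (s' : S) : |noise M d Q y z s'| ≤ 4 * (1 / (1 - M.γ)) := by
  have hH := M.one_le_horizon
  have h1 : |if y = z then tdError M Q y s' else 0| ≤ 2 * (1 / (1 - M.γ)) := by
    split_ifs
    · exact abs_tdError_le hr hQ y s'
    · rw [abs_zero]; linarith
  have h2 : |d y * drift M Q y| ≤ 2 * (1 / (1 - M.γ)) := by
    rw [abs_mul, abs_of_nonneg hd]
    exact (mul_le_of_le_one_left (abs_nonneg _) hd1).trans (abs_drift_le hr hQ y)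
  refine (abs_sub _ _).trans ?_
  linarith

/-- As `α_k ≤ 1`, the new entry is a convex combination of the old one and the target `r + γ max Q`.
With `H = 1/(1-γ)`, the interval `[-H, H]` is invariant because `1 + γ H = H`. -/
lemma abs_qIter_le (hr : ∀ s a s', |M.r s a s'| ≤ 1) (hQ₀ : ∀ y, |Q₀ y| ≤ 1)
    (hα : ∀ k, 0 ≤ α k) (hα1 : ∀ k, α k ≤ 1) (k : ℕ) (y : S × A) :
    |qIter M α Q₀ x k y| ≤ 1 / (1 - M.γ) := by
  induction k generalizing y with
  | zero => exact (hQ₀ y).trans M.one_le_horizon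
  | succ k ih =>
    rw [qIter_succ]
    split_ifs
    · set Q := qIter M α Q₀ x k
      have h1 := abs_le.1 (abs_tdError_add_le hr ih y (x (k + 1)).1)
      have h2 := abs_le.1 (ih y)
      have h3 := hα k
      have h4 := sub_nonneg.2 (hα1 k)
      have : Q y + α k * tdError M Q y (x (k + 1)).1
          = (1 - α k) * Q y + α k * (tdError M Q y (x (k + 1)).1 + Q y) := by ring
      rw [this]
      exact abs_le.2 ⟨by nlinarith, by nlinarith⟩
    · simpa using ih y

lemma abs_qIter_succ_sub_le (hr : ∀ s a s', |M.r s a s'| ≤ 1) (hQ₀ : ∀ y, |Q₀ y| ≤ 1)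
    (hα : ∀ k, 0 ≤ α k) (hα1 : ∀ k, α k ≤ 1) (k : ℕ) (y : S × A) :
    |qIter M α Q₀ x (k + 1) y - qIter M α Q₀ x k y| ≤ α k * (2 * (1 / (1 - M.γ))) := by
  have hH := M.one_le_horizon
  rw [qIter_succ, add_sub_cancel_left]
  split_ifs
  · rw [abs_mul, abs_of_nonneg (hα k)]
    exact mul_le_mul_of_nonneg_left
      (abs_tdError_le hr (abs_qIter_le hr hQ₀ hα hα1 k) y _) (hα k)
  · rw [abs_zero]
    exact mul_nonneg (hα k) (by linarith)

lemma abs_ite_noise_le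
    (hr : ∀ s a s', |M.r s a s'| ≤ 1) (hQ₀ : ∀ y, |Q₀ y| ≤ 1) (hα : ∀ k, 0 ≤ α k)
    (hα1 : ∀ k, α k ≤ 1) (hd : ∀ y, 0 ≤ d y) (hd1 : ∀ y, d y ≤ 1)
    (k : ℕ) (y : S × A) :
    |if k₀ ≤ k then noise M d (qIter M α Q₀ x k) y (x k) (x (k + 1)).1 else 0|
      ≤ 4 * (1 / (1 - M.γ)) := by
  have hH := M.one_le_horizon
  split_ifs
  · exact abs_noise_le hr (abs_qIter_le hr hQ₀ hα hα1 k) (hd y) (hd1 y) _ _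
  · rw [abs_zero]; linarith

/-- Multiplied by `d y`, the filter step is a convex combination with weights `1 - α_k d y` and `α_k
d y`, so the bound on the noise propagates without any factor `1 / d y`. -/
lemma mul_abs_filteredNoise_le
    (hr : ∀ s a s', |M.r s a s'| ≤ 1) (hQ₀ : ∀ y, |Q₀ y| ≤ 1) (hα : ∀ k, 0 ≤ α k)
    (hα1 : ∀ k, α k ≤ 1) (hd : ∀ y, 0 ≤ d y) (hd1 : ∀ y, d y ≤ 1)
    (k : ℕ) (y : S × A) :
    d y * |filteredNoise M α Q₀ d k₀ x k y| ≤ 4 * (1 / (1 - M.γ)) := by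
  have hH := M.one_le_horizon
  induction k with
  | zero => simp only [filteredNoise, Pi.zero_apply, abs_zero, mul_zero]; linarith
  | succ k ih =>
    have h1 := abs_ite_noise_le (x := x) (k₀ := k₀) hr hQ₀ hα hα1 hd hd1 k y
    have h2 : 0 ≤ α k * d y := mul_nonneg (hα k) (hd y)
    have h3 : 0 ≤ 1 - α k * d y := sub_nonneg.2 (mul_le_one₀ (hα1 k) (hd y) (hd1 y))
    simp only [filteredNoise]
    calc _ ≤ d y * ((1 - α k * d y) * |filteredNoise M α Q₀ d k₀ x k y|
          + α k * |if k₀ ≤ k then noise M d (qIter M α Q₀ x k) y (x k) (x (k + 1)).1 else 0|) := by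
          refine mul_le_mul_of_nonneg_left ((abs_add_le _ _).trans_eq ?_) (hd y)
          rw [abs_mul, abs_mul, abs_of_nonneg h3, abs_of_nonneg (hα k)]
      _ = (1 - α k * d y) * (d y * |filteredNoise M α Q₀ d k₀ x k y|) + (α k * d y)
          * |if k₀ ≤ k then noise M d (qIter M α Q₀ x k) y (x k) (x (k + 1)).1 else 0| := by ring
      _ ≤ (1 - α k * d y) * (4 * (1 / (1 - M.γ))) + (α k * d y) * (4 * (1 / (1 - M.γ))) :=
          add_le_add (mul_le_mul_of_nonneg_left ih h3) (mul_le_mul_of_nonneg_left h1 h2)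
      _ = _ := by ring

lemma abs_filteredNoise_succ_sub_le
    (hr : ∀ s a s', |M.r s a s'| ≤ 1) (hQ₀ : ∀ y, |Q₀ y| ≤ 1) (hα : ∀ k, 0 ≤ α k)
    (hα1 : ∀ k, α k ≤ 1) (hd : ∀ y, 0 ≤ d y) (hd1 : ∀ y, d y ≤ 1)
    (k : ℕ) (y : S × A) :
    |filteredNoise M α Q₀ d k₀ x (k + 1) y - filteredNoise M α Q₀ d k₀ x k y|
      ≤ α k * (8 * (1 / (1 - M.γ))) := by
  have h1 := abs_ite_noise_le (x := x) (k₀ := k₀) hr hQ₀ hα hα1 hd hd1 k y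
  have h2 := mul_abs_filteredNoise_le (x := x) (k₀ := k₀) hr hQ₀ hα hα1 hd hd1 k y
  simp only [filteredNoise]
  rw [show ∀ a b c e : ℝ, (1 - a * b) * c + a * e - c = a * (e - b * c) by intros; ring,
    abs_mul, abs_of_nonneg (hα k)]
  refine mul_le_mul_of_nonneg_left ((abs_sub _ _).trans ?_) (hα k)
  rw [abs_mul, abs_of_nonneg (hd y)]
  linarith

lemma abs_filteredNoise_le
    (hr : ∀ s a s', |M.r s a s'| ≤ 1) (hQ₀ : ∀ y, |Q₀ y| ≤ 1) (hα : ∀ k, 0 ≤ α k)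
    (hα1 : ∀ k, α k ≤ 1) (hd : ∀ y, 0 ≤ d y) (hd1 : ∀ y, d y ≤ 1)
    {D : ℝ} (hD : ∀ y, 1 ≤ D * d y)
    (hD0 : 0 ≤ D) (k : ℕ) (y : S × A) :
    |filteredNoise M α Q₀ d k₀ x k y| ≤ 4 * (1 / (1 - M.γ)) * D := by
  have h1 := mul_abs_filteredNoise_le (x := x) (k₀ := k₀) hr hQ₀ hα hα1 hd hd1 k y
  calc _ ≤ (D * d y) * |filteredNoise M α Q₀ d k₀ x k y| :=
        le_mul_of_one_le_left (abs_nonneg _) (hD y)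
    _ = D * (d y * |filteredNoise M α Q₀ d k₀ x k y|) := by ring
    _ ≤ D * (4 * (1 / (1 - M.γ))) := mul_le_mul_of_nonneg_left h1 hD0
    _ = _ := by ring

lemma abs_filteredNoise_mul_drift_le
    (hr : ∀ s a s', |M.r s a s'| ≤ 1) (hQ₀ : ∀ y, |Q₀ y| ≤ 1) (hα : ∀ k, 0 ≤ α k)
    (hα1 : ∀ k, α k ≤ 1) (hd : ∀ y, 0 ≤ d y) (hd1 : ∀ y, d y ≤ 1)
    {D : ℝ} (hD : ∀ y, 1 ≤ D * d y)
    (hD0 : 0 ≤ D) (k : ℕ) (y : S × A) :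
    |filteredNoise M α Q₀ d k₀ x k y * drift M (qIter M α Q₀ x k) y|
      ≤ 8 * (1 / (1 - M.γ)) ^ 2 * D := by
  rw [abs_mul]
  calc _ ≤ (4 * (1 / (1 - M.γ)) * D) * (2 * (1 / (1 - M.γ))) :=
        mul_le_mul (abs_filteredNoise_le hr hQ₀ hα hα1 hd hd1 hD hD0 k y)
          (abs_drift_le hr (abs_qIter_le hr hQ₀ hα hα1 k) y) (abs_nonneg _)
          (mul_nonneg (by linarith [M.one_le_horizon]) hD0)
    _ = _ := by ring

/-- The product rule: both the filter and the drift move by `O(α_k)` in one step. This measures the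
cost of freezing their product at an earlier time. -/
lemma abs_filteredNoise_mul_drift_succ_sub_le
    (hr : ∀ s a s', |M.r s a s'| ≤ 1) (hQ₀ : ∀ y, |Q₀ y| ≤ 1) (hα : ∀ k, 0 ≤ α k)
    (hα1 : ∀ k, α k ≤ 1) (hd : ∀ y, 0 ≤ d y) (hd1 : ∀ y, d y ≤ 1)
    {D : ℝ} (hD : ∀ y, 1 ≤ D * d y)
    (hD1 : 1 ≤ D) (k : ℕ) (y : S × A) :
    |filteredNoise M α Q₀ d k₀ x (k + 1) y * drift M (qIter M α Q₀ x (k + 1)) y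
        - filteredNoise M α Q₀ d k₀ x k y * drift M (qIter M α Q₀ x k) y|
      ≤ α k * (32 * (1 / (1 - M.γ)) ^ 2 * D) := by
  set U := filteredNoise M α Q₀ d k₀ x
  set G := fun k => drift M (qIter M α Q₀ x k) y
  set H := 1 / (1 - M.γ)
  have hH : 1 ≤ H := M.one_le_horizon
  have hU : |U k y| ≤ 4 * H * D :=
    abs_filteredNoise_le hr hQ₀ hα hα1 hd hd1 hD (by linarith) k y
  have hdU : |U (k + 1) y - U k y| ≤ α k * (8 * H) :=
    abs_filteredNoise_succ_sub_le hr hQ₀ hα hα1 hd hd1 k y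
  have hG : |G (k + 1)| ≤ 2 * H := abs_drift_le hr (abs_qIter_le hr hQ₀ hα hα1 _) y
  have hdG : |G (k + 1) - G k| ≤ 2 * (α k * (2 * H)) :=
    abs_drift_sub_le (abs_qIter_succ_sub_le hr hQ₀ hα hα1 k) y
  change |U (k + 1) y * G (k + 1) - U k y * G k| ≤ _
  rw [show U (k + 1) y * G (k + 1) - U k y * G k
    = (U (k + 1) y - U k y) * G (k + 1) + U k y * (G (k + 1) - G k) by ring]
  have hα0 := hα k
  calc _ ≤ |U (k + 1) y - U k y| * |G (k + 1)| + |U k y| * |G (k + 1) - G k| := by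
        refine (abs_add_le _ _).trans_eq ?_
        rw [abs_mul, abs_mul]
    _ ≤ (α k * (8 * H)) * (2 * H) + (4 * H * D) * (2 * (α k * (2 * H))) := by gcongr
    _ = α k * (16 * H ^ 2 * 1) + α k * (16 * H ^ 2 * D) := by ring
    _ ≤ α k * (16 * H ^ 2 * D) + α k * (16 * H ^ 2 * D) := by gcongr
    _ = _ := by ring

lemma abs_filteredNoise_mul_drift_add_sub_le
    (hr : ∀ s a s', |M.r s a s'| ≤ 1) (hQ₀ : ∀ y, |Q₀ y| ≤ 1) (hα : ∀ k, 0 ≤ α k)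
    (hα1 : ∀ k, α k ≤ 1) (hd : ∀ y, 0 ≤ d y) (hd1 : ∀ y, d y ≤ 1)
    {D : ℝ} (hD : ∀ y, 1 ≤ D * d y)
    (hD1 : 1 ≤ D) (hanti : Antitone α) (k t : ℕ)
    (y : S × A) :
    |filteredNoise M α Q₀ d k₀ x (k + t) y * drift M (qIter M α Q₀ x (k + t)) y
        - filteredNoise M α Q₀ d k₀ x k y * drift M (qIter M α Q₀ x k) y|
      ≤ t * (α k * (32 * (1 / (1 - M.γ)) ^ 2 * D)) := by
  induction t with
  | zero => simp
  | succ t ih =>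
    have h1 := abs_filteredNoise_mul_drift_succ_sub_le (x := x) (k₀ := k₀)
      hr hQ₀ hα hα1 hd hd1 hD hD1 (k + t) y
    have h2 : α (k + t) * (32 * (1 / (1 - M.γ)) ^ 2 * D)
        ≤ α k * (32 * (1 / (1 - M.γ)) ^ 2 * D) :=
      mul_le_mul_of_nonneg_right (hanti (Nat.le_add_right k t)) (by positivity)
    have h3 := abs_add_le
      (filteredNoise M α Q₀ d k₀ x (k + t + 1) y * drift M (qIter M α Q₀ x (k + t + 1)) y
        - filteredNoise M α Q₀ d k₀ x (k + t) y * drift M (qIter M α Q₀ x (k + t)) y)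
      (filteredNoise M α Q₀ d k₀ x (k + t) y * drift M (qIter M α Q₀ x (k + t)) y
        - filteredNoise M α Q₀ d k₀ x k y * drift M (qIter M α Q₀ x k) y)
    rw [sub_add_sub_cancel] at h3
    rw [← add_assoc]
    push_cast
    linarith

/-- The error of the iterates without the filtered noise contracts in the maximum norm, up to a
multiple of the filtered noise. -/
lemma supNorm_sub_filteredNoise_succ_le [Nonempty S] (hα : ∀ k, 0 ≤ α k) (hα1 : ∀ k, α k ≤ 1)
    {dmin dmax : ℝ} (hdmin : 0 ≤ dmin) (hd : ∀ y, dmin ≤ d y) (hd' : ∀ y, d y ≤ dmax)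
    (hd1 : ∀ y, d y ≤ 1) {k : ℕ} (hk : k₀ ≤ k) :
    supNorm (qIter M α Q₀ x (k + 1) - qStar M - filteredNoise M α Q₀ d k₀ x (k + 1))
      ≤ (1 - α k * dmin * (1 - M.γ))
          * supNorm (qIter M α Q₀ x k - qStar M - filteredNoise M α Q₀ d k₀ x k)
        + α k * dmax * supNorm (filteredNoise M α Q₀ d k₀ x k) := by
  set Q := qIter M α Q₀ x k
  set U := filteredNoise M α Q₀ d k₀ x k
  set z := supNorm (Q - qStar M - U)
  set u := supNorm U
  have hz : 0 ≤ z := supNorm_nonneg _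
  have hu : 0 ≤ u := supNorm_nonneg _
  refine supNorm_le fun y => ?_
  have hzy : |Q y - qStar M y - U y| ≤ z := abs_le_supNorm (Q - qStar M - U) y
  have hT : |bellman M Q y - qStar M y| ≤ M.γ * (z + u) := by
    conv_lhs => rw [← bellman_qStar M]
    refine abs_bellman_sub_le M (fun w => ?_) y
    have h1 : |Q w - qStar M w - U w| ≤ z := abs_le_supNorm (Q - qStar M - U) w
    have h2 := abs_add_le (Q w - qStar M w - U w) (U w)
    rw [sub_add_cancel] at h2
    linarith [abs_le_supNorm U w]
  -- The noise cancels between `Q` and `U`. What drives the remainder is `TQ - Q*`, which sees the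
  -- noise only through `γ ‖U‖`.
  have heq : (qIter M α Q₀ x (k + 1) - qStar M - filteredNoise M α Q₀ d k₀ x (k + 1)) y
      = (1 - α k * d y) * (Q y - qStar M y - U y) + α k * d y * (bellman M Q y - qStar M y) := by
    simp only [Pi.sub_apply, qIter_succ, filteredNoise, hk, if_true, noise, drift]
    split_ifs <;> ring
  have h0 : 0 ≤ α k * d y := mul_nonneg (hα k) (hdmin.trans (hd y))
  have h1 : 0 ≤ 1 - α k * d y :=
    sub_nonneg.2 (mul_le_one₀ (hα1 k) (hdmin.trans (hd y)) (hd1 y))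
  have h2 : 0 ≤ 1 - M.γ := sub_nonneg.2 M.γ_lt_one.le
  rw [heq]
  calc _ ≤ (1 - α k * d y) * |Q y - qStar M y - U y|
        + α k * d y * |bellman M Q y - qStar M y| := by
        refine (abs_add_le _ _).trans_eq ?_
        rw [abs_mul, abs_mul, abs_of_nonneg h0, abs_of_nonneg h1]
    _ ≤ (1 - α k * d y) * z + α k * d y * (M.γ * (z + u)) := by gcongr
    _ = (1 - α k * d y * (1 - M.γ)) * z + α k * d y * (M.γ * u) := by ring
    _ ≤ (1 - α k * dmin * (1 - M.γ)) * z + α k * dmax * u := by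
        have h3 : M.γ * u ≤ u := mul_le_of_le_one_left hu M.γ_lt_one.le
        have h4 := hα k
        have h5 : 0 ≤ M.γ * u := mul_nonneg M.γ_nonneg hu
        have h6 := hd y
        have h7 := hd' y
        have h8 := (hdmin.trans h6).trans h7
        gcongr

end Paths

/-! ### Decay of scalar recursions with linear step-size. -/

section Recursions

/-- A recursion with contraction `1 - 2 / aⱼ` and perturbation `b / aⱼ²` decays like `1 / aⱼ`. -/
lemma le_div_of_recursion {u : ℕ → ℝ} {ξ b : ℝ} (hξ : 2 ≤ ξ) (hb : 0 ≤ b) {k₀ : ℕ}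
    (h0 : u k₀ ≤ 0) {k : ℕ} (hk : k₀ ≤ k)
    (hstep : ∀ j, k₀ ≤ j → j < k →
      u (j + 1) ≤ (1 - 2 / (j + ξ)) * u j + b / (j + ξ) ^ 2) :
    u k ≤ b / (k + ξ) := by
  induction k, hk using Nat.le_induction with
  | base => exact h0.trans (by positivity)
  | succ j hj ih =>
    have ih := ih fun i hi hij => hstep i hi (hij.trans j.lt_succ_self)
    refine (hstep j hj j.lt_succ_self).trans ?_
    have ha : (2 : ℝ) ≤ j + ξ := by linarith [(Nat.cast_nonneg j : (0 : ℝ) ≤ j)]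
    push_cast
    rw [show (j : ℝ) + 1 + ξ = j + ξ + 1 by ring]
    set a := (j : ℝ) + ξ
    have ha0 : 0 < a := by linarith
    have h1 : 0 ≤ 1 - 2 / a := by
      rw [sub_nonneg, div_le_one ha0]; exact ha
    calc _ ≤ (1 - 2 / a) * (b / a) + b / a ^ 2 :=
          add_le_add_left (mul_le_mul_of_nonneg_left ih h1) _
      _ = b * ((a - 1) / a ^ 2) := by field_simp; ring
      -- This is `(a - 1)(a + 1) ≤ a²`.
      _ ≤ b * (1 / (a + 1)) := by
          refine mul_le_mul_of_nonneg_left ?_ hb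
          rw [div_le_div_iff₀ (by positivity) (by positivity)]
          nlinarith
      _ = b / (a + 1) := by ring

/-- A recursion with contraction `1 - 2 / aⱼ` and perturbation `b / (aⱼ √aⱼ)` decays like
`1 / √aⱼ`. -/
lemma le_div_sqrt_of_recursion {z : ℕ → ℝ} {ξ b c : ℝ} (hξ : 2 ≤ ξ) (hb : 0 ≤ b) (hc : 0 ≤ c)
    {k₀ : ℕ} (h0 : z k₀ ≤ c) {k : ℕ} (hk : k₀ ≤ k)
    (hstep : ∀ j, k₀ ≤ j → j < k →
      z (j + 1) ≤ (1 - 2 / (j + ξ)) * z j + b / ((j + ξ) * √(j + ξ))) :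
    z k ≤ (b + c * √(k₀ + ξ)) / √(k + ξ) := by
  have hB : 0 ≤ b + c * √(k₀ + ξ) := by positivity
  have hbB : b ≤ b + c * √(k₀ + ξ) := le_add_of_nonneg_right (by positivity)
  induction k, hk using Nat.le_induction with
  | base =>
    have : 0 < √(k₀ + ξ) := Real.sqrt_pos.2 (by positivity)
    rw [le_div_iff₀ this]
    nlinarith
  | succ j hj ih =>
    have ih := ih fun i hi hij => hstep i hi (hij.trans j.lt_succ_self)
    refine (hstep j hj j.lt_succ_self).trans ?_
    have ha : (2 : ℝ) ≤ j + ξ := by linarith [(Nat.cast_nonneg j : (0 : ℝ) ≤ j)]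
    push_cast
    rw [show (j : ℝ) + 1 + ξ = j + ξ + 1 by ring]
    set a := (j : ℝ) + ξ
    set B := b + c * √(k₀ + ξ)
    have ha0 : 0 < a := by linarith
    have hs : 0 < √a := Real.sqrt_pos.2 ha0
    have h1 : 0 ≤ 1 - 2 / a := by
      rw [sub_nonneg, div_le_one ha0]; exact ha
    -- Of the contraction `2 / a`, one half absorbs the perturbation `B / (a √a)`; the other half
    -- pays for the passage from `1/√a` to `1/√(a+1)`.
    have h2 : (1 - 1 / a) / √a ≤ 1 / √(a + 1) := by
      rw [div_le_div_iff₀ hs (Real.sqrt_pos.2 (by linarith)), one_mul]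
      refine Real.le_sqrt_of_sq_le ?_
      rw [mul_pow, Real.sq_sqrt (by linarith)]
      have : (1 - 1 / a) ^ 2 * (a + 1) = a - (1 + 1 / a) + 1 / a ^ 2 := by field_simp; ring
      rw [this]
      have h3 : 1 / a ^ 2 ≤ 1 / a := by
        rw [div_le_div_iff₀ (by positivity) ha0]; nlinarith
      linarith
    calc _ ≤ (1 - 2 / a) * (B / √a) + B / (a * √a) :=
          add_le_add (mul_le_mul_of_nonneg_left ih h1)
            (div_le_div_of_nonneg_right hbB (by positivity))
      _ = B * ((1 - 1 / a) / √a) := by field_simp; ring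
      _ ≤ B * (1 / √(a + 1)) := mul_le_mul_of_nonneg_left h2 hB
      _ = B / √(a + 1) := by ring

end Recursions

/-! ### The second moment of the filtered noise. -/

section Expectation

variable {S A : Type*} [Fintype S] [Fintype A] [DecidableEq S] [DecidableEq A] [Nonempty A]
  {M : MDP S A} {β : Policy S A} {α : ℕ → ℝ} {Q₀ d : S × A → ℝ} {k₀ : ℕ}
  {Ω : Type*} [MeasurableSpace Ω] {ℙ : Measure Ω} [IsProbabilityMeasure ℙ] {X : ℕ → Ω → S × A}

lemma sum_chain_mul (M : MDP S A) (β : Policy S A) (x : S × A) (g : S → ℝ) :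
    ∑ z, chain M β x z * g z.1 = ∑ s, M.P x.1 x.2 s * g s := by
  simp only [chain, Fintype.sum_prod_type]
  refine Finset.sum_congr rfl fun s _ => ?_
  rw [← Finset.sum_mul, ← Finset.mul_sum, β.sum_eq_one, mul_one]

lemma dependsOn_comp_qIter_filteredNoise {E : Type*} (k : ℕ)
    (G : (S × A → ℝ) → (S × A → ℝ) → S × A → E) :
    DependsOn (fun x => G (qIter M α Q₀ x k) (filteredNoise M α Q₀ d k₀ x k) (x k))
      (Set.Iic k) := by
  intro x x' h
  have h1 : qIter M α Q₀ x k = qIter M α Q₀ x' k := dependsOn_qIter k h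
  have h2 : filteredNoise M α Q₀ d k₀ x k = filteredNoise M α Q₀ d k₀ x' k :=
    dependsOn_filteredNoise k h
  simp only [h1, h2, h k Set.self_mem_Iic]

/-- Averaging over the next state removes the martingale part of the noise. -/
lemma integral_filteredNoise_mul_noise (hX : IsMarkovChain ℙ (chain M β) X) (k : ℕ) (y : S × A) :
    ∫ ω, filteredNoise M α Q₀ d k₀ (fun i => X i ω) k y
        * noise M d (qIter M α Q₀ (fun i => X i ω) k) y (X k ω) (X (k + 1) ω).1 ∂ℙ
      = ∫ ω, filteredNoise M α Q₀ d k₀ (fun i => X i ω) k y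
        * drift M (qIter M α Q₀ (fun i => X i ω) k) y
        * ((if X k ω = y then 1 else 0) - d y) ∂ℙ := by
  rw [hX.integral_next (F := fun x z => filteredNoise M α Q₀ d k₀ x k y
      * noise M d (qIter M α Q₀ x k) y (x k) z.1) (k := k) fun z =>
    dependsOn_comp_qIter_filteredNoise k fun Q U w => U y * noise M d Q y w z.1]
  refine integral_congr_ae (Filter.Eventually.of_forall fun ω => ?_)
  set U := filteredNoise M α Q₀ d k₀ (fun i => X i ω) k
  set Q := qIter M α Q₀ (fun i => X i ω) k
  have h := sum_chain_mul M β (X k ω) fun s => U y * noise M d Q y (X k ω) s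
  simp only at h ⊢
  rw [h]
  simp only [noise, mul_sub, Finset.sum_sub_distrib, ← Finset.sum_mul, M.P_sum, one_mul]
  by_cases hy : X k ω = y
  · subst hy
    simp only [if_true, ← sum_mul_tdError, Finset.mul_sum, mul_one]
    congr 1
    · exact Finset.sum_congr rfl fun s _ => by ring
    · rw [Finset.sum_mul]
      exact Finset.sum_congr rfl fun s _ => by ring
  · simp only [if_neg hy, if_neg (Ne.symm hy), mul_zero, Finset.sum_const_zero]
    ring

/-- The correlation of the filtered noise with the new noise, when the chain mixes in `t` steps. -/
lemma abs_integral_filteredNoise_mul_noise_le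
    {D : ℝ} (hX : IsMarkovChain ℙ (chain M β) X) (hr : ∀ s a s', |M.r s a s'| ≤ 1)
    (hQ₀ : ∀ y, |Q₀ y| ≤ 1) (hα : ∀ k, 0 ≤ α k) (hα1 : ∀ k, α k ≤ 1) (hd : ∀ y, 0 ≤ d y)
    (hd1 : ∀ y, d y ≤ 1) (hD : ∀ y, 1 ≤ D * d y) (hD1 : 1 ≤ D) (hanti : Antitone α)
    {j t : ℕ} {y : S × A}
    (hmix : ∀ x, |(chain M β ^ t) x y - d y| ≤ α (j + t)) (hdouble : α j ≤ 2 * α (j + t)) :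
    |∫ ω, filteredNoise M α Q₀ d k₀ (fun i => X i ω) (j + t) y
        * noise M d (qIter M α Q₀ (fun i => X i ω) (j + t)) y (X (j + t) ω)
          (X (j + t + 1) ω).1 ∂ℙ|
      ≤ 64 * (1 / (1 - M.γ)) ^ 2 * D * (t + 1) * α (j + t) := by
  rw [integral_filteredNoise_mul_noise hX]
  set H := 1 / (1 - M.γ)
  set V : ℕ → (ℕ → S × A) → ℝ := fun k x =>
    filteredNoise M α Q₀ d k₀ x k y * drift M (qIter M α Q₀ x k) y
  set I : Ω → ℝ := fun ω => (if X (j + t) ω = y then 1 else 0) - d y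
  have hVj : DependsOn (V j) (Set.Iic j) :=
    dependsOn_comp_qIter_filteredNoise j fun Q U _ => U y * drift M Q y
  have hint1 : Integrable (fun ω => V j (fun i => X i ω) * I ω) ℙ :=
    hX.integrable (k := j + t) (f := fun x => V j x * ((if x (j + t) = y then 1 else 0) - d y))
      fun x x' h => by
        simp only [hVj fun i hi => h i ((Set.mem_Iic.1 hi).trans (Nat.le_add_right j t)),
          h (j + t) Set.self_mem_Iic]
  have hint2 : Integrable (fun ω => V (j + t) (fun i => X i ω) * I ω) ℙ :=
    hX.integrable (dependsOn_comp_qIter_filteredNoise (j + t) fun Q U w =>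
      U y * drift M Q y * ((if w = y then 1 else 0) - d y))
  have hI : ∀ ω, |I ω| ≤ 1 := by
    intro ω
    have h1 := hd y
    have h2 := hd1 y
    simp only [I]
    split_ifs <;> exact abs_le.2 ⟨by linarith, by linarith⟩
  -- The functional frozen at time `j` is nearly uncorrelated with `I`, by mixing over `t` steps;
  -- `h2` bounds the cost of freezing it.
  have h1 : |∫ ω, V j (fun i => X i ω) * I ω ∂ℙ| ≤ 8 * H ^ 2 * D * α (j + t) :=
    hX.abs_integral_mul_sub_le (chain_mem_rowStochastic M β) hVj
      (fun x => abs_filteredNoise_mul_drift_le hr hQ₀ hα hα1 hd hd1 hD (by linarith) j y) hmix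
  have h2 : |∫ ω, (V (j + t) (fun i => X i ω) * I ω - V j (fun i => X i ω) * I ω) ∂ℙ|
      ≤ t * (α j * (32 * H ^ 2 * D)) := by
    have := norm_integral_le_of_norm_le_const (μ := ℙ) (C := t * (α j * (32 * H ^ 2 * D)))
      (f := fun ω => V (j + t) (fun i => X i ω) * I ω - V j (fun i => X i ω) * I ω)
      (Filter.Eventually.of_forall fun ω => by
        rw [← sub_mul, norm_mul]
        exact (mul_le_of_le_one_right (norm_nonneg _) (hI ω)).trans
          (abs_filteredNoise_mul_drift_add_sub_le hr hQ₀ hα hα1 hd hd1 hD hD1 hanti j t y))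
    simpa using this
  rw [integral_sub hint2 hint1] at h2
  have h3 := abs_add_le (∫ ω, V (j + t) (fun i => X i ω) * I ω ∂ℙ
    - ∫ ω, V j (fun i => X i ω) * I ω ∂ℙ) (∫ ω, V j (fun i => X i ω) * I ω ∂ℙ)
  rw [sub_add_cancel] at h3
  refine h3.trans ((add_le_add h2 h1).trans ?_)
  have hHD : 0 ≤ H ^ 2 * D := by positivity
  have h4 : t * (α j * (32 * H ^ 2 * D)) ≤ t * (2 * α (j + t) * (32 * H ^ 2 * D)) := by gcongr
  have h5 : 0 ≤ H ^ 2 * D * α (j + t) := mul_nonneg hHD (hα _)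
  linarith

/-- The square of the filter step is expanded. The cross term contributes `2 * 64` and the squared
noise `4 ^ 2`, whence `144`; one of the two factors `1 - α d y` is dropped from the quadratic term.
-/
lemma integral_sq_filteredNoise_succ_le
    {D : ℝ} (hX : IsMarkovChain ℙ (chain M β) X) (hr : ∀ s a s', |M.r s a s'| ≤ 1)
    (hQ₀ : ∀ y, |Q₀ y| ≤ 1) (hα : ∀ k, 0 ≤ α k) (hα1 : ∀ k, α k ≤ 1) (hd : ∀ y, 0 ≤ d y)
    (hd1 : ∀ y, d y ≤ 1) (hD : ∀ y, 1 ≤ D * d y) (hD1 : 1 ≤ D) (hanti : Antitone α)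
    {j t : ℕ} {y : S × A} (hk : k₀ ≤ j + t)
    (hmix : ∀ x, |(chain M β ^ t) x y - d y| ≤ α (j + t)) (hdouble : α j ≤ 2 * α (j + t)) :
    ∫ ω, filteredNoise M α Q₀ d k₀ (fun i => X i ω) (j + t + 1) y ^ 2 ∂ℙ
      ≤ (1 - α (j + t) * d y) * ∫ ω, filteredNoise M α Q₀ d k₀ (fun i => X i ω) (j + t) y ^ 2 ∂ℙ
        + 144 * (1 / (1 - M.γ)) ^ 2 * D * (t + 1) * α (j + t) ^ 2 := by
  have hcross := abs_integral_filteredNoise_mul_noise_le (k₀ := k₀) hX hr hQ₀ hα hα1 hd hd1 hD hD1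
    hanti hmix hdouble
  set H := 1 / (1 - M.γ)
  set k := j + t
  set a := α k
  set U : Ω → ℝ := fun ω => filteredNoise M α Q₀ d k₀ (fun i => X i ω) k y
  set w : Ω → ℝ := fun ω =>
    noise M d (qIter M α Q₀ (fun i => X i ω) k) y (X k ω) (X (k + 1) ω).1
  have ha0 : 0 ≤ a := hα k
  have had : 0 ≤ a * d y := mul_nonneg ha0 (hd y)
  have had1 : 0 ≤ 1 - a * d y := sub_nonneg.2 (mul_le_one₀ (hα1 k) (hd y) (hd1 y))
  have hU2 : Integrable (fun ω => U ω ^ 2) ℙ :=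
    hX.integrable (dependsOn_comp_qIter_filteredNoise k fun _ U _ => U y ^ 2)
  have hdep : ∀ g : ℝ → ℝ → ℝ, Integrable (fun ω => g (U ω) (w ω)) ℙ := fun g =>
    hX.integrable (k := k + 1) (f := fun x => g (filteredNoise M α Q₀ d k₀ x k y)
        (noise M d (qIter M α Q₀ x k) y (x k) (x (k + 1)).1)) fun x x' h => by
      have h1 : qIter M α Q₀ x k = qIter M α Q₀ x' k :=
        dependsOn_qIter k fun i hi => h i (Nat.le_succ_of_le hi)
      have h2 : filteredNoise M α Q₀ d k₀ x k = filteredNoise M α Q₀ d k₀ x' k :=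
        dependsOn_filteredNoise k fun i hi => h i (Nat.le_succ_of_le hi)
      simp only [h1, h2, h k (Nat.le_succ k), h (k + 1) Set.self_mem_Iic]
  have hUw : Integrable (fun ω => U ω * w ω) ℙ := hdep fun u v => u * v
  have hexp : ∀ ω, filteredNoise M α Q₀ d k₀ (fun i => X i ω) (k + 1) y ^ 2
      ≤ (1 - a * d y) * U ω ^ 2 + 2 * a * (1 - a * d y) * (U ω * w ω) + a ^ 2 * (4 * H) ^ 2 := by
    intro ω
    have h1 : filteredNoise M α Q₀ d k₀ (fun i => X i ω) (k + 1) y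
        = (1 - a * d y) * U ω + a * w ω := by
      simp only [filteredNoise, hk, if_true]
      rfl
    have h2 : w ω ^ 2 ≤ (4 * H) ^ 2 :=
      sq_le_sq' (abs_le.1 (abs_noise_le hr (abs_qIter_le hr hQ₀ hα hα1 k) (hd y) (hd1 y) _ _)).1
        (abs_le.1 (abs_noise_le hr (abs_qIter_le hr hQ₀ hα hα1 k) (hd y) (hd1 y) _ _)).2
    have h3 : (1 - a * d y) * (1 - a * d y) * U ω ^ 2 ≤ (1 - a * d y) * U ω ^ 2 :=
      mul_le_mul_of_nonneg_right (mul_le_of_le_one_right had1 (by linarith)) (sq_nonneg _)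
    have h4 : a ^ 2 * w ω ^ 2 ≤ a ^ 2 * (4 * H) ^ 2 :=
      mul_le_mul_of_nonneg_left h2 (sq_nonneg a)
    rw [h1]
    linarith
  have hadd : Integrable
      (fun ω => (1 - a * d y) * U ω ^ 2 + 2 * a * (1 - a * d y) * (U ω * w ω)) ℙ :=
    (hU2.const_mul _).add (hUw.const_mul _)
  calc _ ≤ ∫ ω, ((1 - a * d y) * U ω ^ 2 + 2 * a * (1 - a * d y) * (U ω * w ω)
        + a ^ 2 * (4 * H) ^ 2) ∂ℙ :=
        integral_mono
          (hX.integrable (dependsOn_comp_qIter_filteredNoise (k + 1) fun _ U _ => U y ^ 2))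
          (hadd.add (integrable_const _)) hexp
    _ = (1 - a * d y) * ∫ ω, U ω ^ 2 ∂ℙ + 2 * a * (1 - a * d y) * ∫ ω, U ω * w ω ∂ℙ
        + a ^ 2 * (4 * H) ^ 2 := by
        rw [integral_add hadd (integrable_const _), integral_add (hU2.const_mul _) (hUw.const_mul _), integral_const_mul,
          integral_const_mul]
        simp
    _ ≤ (1 - a * d y) * ∫ ω, U ω ^ 2 ∂ℙ
        + 2 * a * 1 * (64 * H ^ 2 * D * (t + 1) * a) + a ^ 2 * (4 * H) ^ 2 := by
        have h1 : 2 * a * (1 - a * d y) * ∫ ω, U ω * w ω ∂ℙ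
            ≤ 2 * a * (1 - a * d y) * (64 * H ^ 2 * D * (t + 1) * a) :=
          mul_le_mul_of_nonneg_left ((le_abs_self _).trans hcross) (by positivity)
        have h2 : 2 * a * (1 - a * d y) * (64 * H ^ 2 * D * (t + 1) * a)
            ≤ 2 * a * 1 * (64 * H ^ 2 * D * (t + 1) * a) := by
          gcongr
          linarith
        linarith
    _ ≤ _ := by
        have h1 : (1 : ℝ) ≤ D * (t + 1) :=
          one_le_mul_of_one_le_of_one_le hD1 (by linarith [(Nat.cast_nonneg t : (0 : ℝ) ≤ t)])
        have h2 : a ^ 2 * (4 * H) ^ 2 * 1 ≤ a ^ 2 * (4 * H) ^ 2 * (D * (t + 1)) :=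
          mul_le_mul_of_nonneg_left h1 (by positivity)
        linarith

end Expectation

/-! ### Mean error bounds for the step-size `θ / (k + ξ)`. -/

lemma stepSize_nonneg {θ ξ : ℝ} (hθ : 0 ≤ θ) (hξ : 0 ≤ ξ) (k : ℕ) : 0 ≤ stepSize θ ξ k := by
  unfold stepSize; positivity

lemma stepSize_le_one {θ ξ : ℝ} (hξ : 0 < ξ) (hθξ : θ ≤ ξ) (k : ℕ) : stepSize θ ξ k ≤ 1 := by
  have : (0 : ℝ) ≤ k := Nat.cast_nonneg k
  rw [stepSize, div_le_one (by linarith)]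
  linarith

lemma antitone_stepSize {θ ξ : ℝ} (hθ : 0 ≤ θ) (hξ : 0 < ξ) : Antitone (stepSize θ ξ) := by
  intro i j hij
  have : (i : ℝ) ≤ j := by exact_mod_cast hij
  unfold stepSize
  gcongr

/-- If `s²` has small mean, so has `s`. -/
lemma integral_le_sqrt {Ω : Type*} [MeasurableSpace Ω] {ℙ : Measure Ω} [IsProbabilityMeasure ℙ]
    {s v : Ω → ℝ} (hs : Integrable s ℙ) (hv : Integrable v ℙ) (hsv : ∀ ω, s ω ^ 2 ≤ v ω)
    {b : ℝ} (hb : 0 < b) (hvb : ∫ ω, v ω ∂ℙ ≤ b) : ∫ ω, s ω ∂ℙ ≤ √b := by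
  have hc : 0 < √b := Real.sqrt_pos.2 hb
  have hc2 : √b ^ 2 = b := Real.sq_sqrt hb.le
  have h : ∫ ω, 2 * √b * s ω ∂ℙ ≤ ∫ ω, (b + v ω) ∂ℙ := by
    refine integral_mono (hs.const_mul _) ((integrable_const _).add hv) fun ω => ?_
    simp only
    -- The inequality `2 √b s ≤ b + s²`, integrated, takes the place of Cauchy-Schwarz.
    nlinarith [sq_nonneg (√b - s ω), hsv ω]
  rw [integral_const_mul, integral_add (integrable_const _) hv] at h
  simp only [integral_const, probReal_univ, one_smul] at h
  nlinarith

section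

variable {S A : Type*} [Fintype S] [Fintype A] [DecidableEq S] [DecidableEq A] [Nonempty S]
  [Nonempty A] {M : MDP S A} {β : Policy S A} {Q₀ d : S × A → ℝ} {k₀ k : ℕ} {θ ξ D T : ℝ}
  {Ω : Type*} [MeasurableSpace Ω] {ℙ : Measure Ω} [IsProbabilityMeasure ℙ] {X : ℕ → Ω → S × A}

/-- The condition `2 ≤ θ * d y` makes the contraction at least `2 / (j + ξ)`, which yields the decay
`1 / (k + ξ)`. The mixing lag `t` may vary with `j` as long as it stays below `T`. -/
lemma integral_sq_filteredNoise_le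
    (hX : IsMarkovChain ℙ (chain M β) X) (hr : ∀ s a s', |M.r s a s'| ≤ 1)
    (hQ₀ : ∀ y, |Q₀ y| ≤ 1) (hd : ∀ y, 0 ≤ d y) (hd1 : ∀ y, d y ≤ 1) (hD : ∀ y, 1 ≤ D * d y)
    (hD1 : 1 ≤ D) (hθ : ∀ y, 2 ≤ θ * d y) (hξ : 2 ≤ ξ) (hθξ : θ ≤ ξ) (hT : 0 ≤ T)
    (hmix : ∀ j, k₀ ≤ j → j < k → ∃ t : ℕ, t ≤ j ∧ (t : ℝ) ≤ T
      ∧ (∀ x y, |(chain M β ^ t) x y - d y| ≤ stepSize θ ξ j)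
      ∧ stepSize θ ξ (j - t) ≤ 2 * stepSize θ ξ j)
    (hk : k₀ ≤ k) (y : S × A) :
    ∫ ω, filteredNoise M (stepSize θ ξ) Q₀ d k₀ (fun i => X i ω) k y ^ 2 ∂ℙ
      ≤ 144 * (1 / (1 - M.γ)) ^ 2 * D * (T + 1) * θ ^ 2 / (k + ξ) := by
  have hθ0 : 0 ≤ θ := by
    by_contra! h
    nlinarith [hθ y, hd y]
  refine le_div_of_recursion (u := fun k => ∫ ω, filteredNoise M (stepSize θ ξ) Q₀ d k₀
    (fun i => X i ω) k y ^ 2 ∂ℙ) hξ (by positivity) (k₀ := k₀) ?_ hk fun j hj hjk => ?_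
  · simp [filteredNoise_eq_zero le_rfl]
  · obtain ⟨t, htj, htT, hm, hdouble⟩ := hmix j hj hjk
    have hjt : j - t + t = j := Nat.sub_add_cancel htj
    have h := integral_sq_filteredNoise_succ_le (k₀ := k₀) (j := j - t) (t := t) (y := y) hX hr hQ₀
      (stepSize_nonneg hθ0 (by linarith)) (stepSize_le_one (by linarith) hθξ) hd hd1 hD hD1
      (antitone_stepSize hθ0 (by linarith))
      (by rwa [hjt]) (by rw [hjt]; exact fun x => hm x y) (by rwa [hjt])
    rw [hjt] at h
    refine h.trans (add_le_add (mul_le_mul_of_nonneg_right ?_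
      (integral_nonneg fun ω => sq_nonneg _)) ?_)
    · have : 2 / (j + ξ) ≤ stepSize θ ξ j * d y := by
        rw [stepSize, div_mul_eq_mul_div]
        exact div_le_div_of_nonneg_right (hθ y) (by positivity)
      linarith
    · rw [stepSize, mul_div_assoc, ← div_pow θ]
      gcongr

/-- Bounding the squared maximum by the sum of squares costs the factor `card (S × A)` under the
root. -/
lemma integral_supNorm_filteredNoise_le
    (hX : IsMarkovChain ℙ (chain M β) X) (hr : ∀ s a s', |M.r s a s'| ≤ 1)
    (hQ₀ : ∀ y, |Q₀ y| ≤ 1) (hd : ∀ y, 0 ≤ d y) (hd1 : ∀ y, d y ≤ 1) (hD : ∀ y, 1 ≤ D * d y)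
    (hD1 : 1 ≤ D) (hθ : ∀ y, 2 ≤ θ * d y) (hξ : 2 ≤ ξ) (hθξ : θ ≤ ξ) (hT : 0 ≤ T)
    (hmix : ∀ j, k₀ ≤ j → j < k → ∃ t : ℕ, t ≤ j ∧ (t : ℝ) ≤ T
      ∧ (∀ x y, |(chain M β ^ t) x y - d y| ≤ stepSize θ ξ j)
      ∧ stepSize θ ξ (j - t) ≤ 2 * stepSize θ ξ j)
    (hk : k₀ ≤ k) :
    ∫ ω, supNorm (filteredNoise M (stepSize θ ξ) Q₀ d k₀ (fun i => X i ω) k) ∂ℙ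
      ≤ 12 * (1 / (1 - M.γ)) * √(Fintype.card (S × A) * D * (T + 1)) * θ / √(k + ξ) := by
  have hθ0 : 0 < θ := by
    by_contra! h
    have y : S × A := Classical.arbitrary _
    nlinarith [hθ y, hd y]
  have hγ : 0 < 1 - M.γ := sub_pos.2 M.γ_lt_one
  have hcard : 0 < Fintype.card (S × A) := Fintype.card_pos
  have hint : ∀ y, Integrable
      (fun ω => filteredNoise M (stepSize θ ξ) Q₀ d k₀ (fun i => X i ω) k y ^ 2) ℙ := fun y =>
    hX.integrable (dependsOn_comp_qIter_filteredNoise k fun _ U _ => U y ^ 2)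
  refine (integral_le_sqrt
    (v := fun ω => ∑ y, filteredNoise M (stepSize θ ξ) Q₀ d k₀ (fun i => X i ω) k y ^ 2)
    (hX.integrable (dependsOn_comp_qIter_filteredNoise k fun _ U _ => supNorm U))
    (integrable_finsetSum _ fun y _ => hint y) (fun ω => ?_) (b := Fintype.card (S × A)
      * (144 * (1 / (1 - M.γ)) ^ 2 * D * (T + 1) * θ ^ 2 / (k + ξ))) (by positivity)
    ?_).trans_eq ?_
  · set U := filteredNoise M (stepSize θ ξ) Q₀ d k₀ (fun i => X i ω) k
    obtain ⟨y, hy⟩ := exists_eq_ciSup_of_finite (f := fun y => |U y|)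
    rw [supNorm, ← hy, sq_abs]
    exact Finset.single_le_sum (f := fun y => U y ^ 2) (fun _ _ => sq_nonneg _)
      (Finset.mem_univ y)
  · rw [integral_finsetSum _ fun y _ => hint y]
    refine (Finset.sum_le_sum fun y _ => integral_sq_filteredNoise_le hX hr hQ₀ hd hd1 hD hD1 hθ
      hξ hθξ hT hmix hk y).trans_eq ?_
    rw [Finset.sum_const, nsmul_eq_mul, Finset.card_univ]
  · rw [show (Fintype.card (S × A) : ℝ)
        * (144 * (1 / (1 - M.γ)) ^ 2 * D * (T + 1) * θ ^ 2 / (k + ξ))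
      = (12 * (1 / (1 - M.γ)) * θ) ^ 2 * (Fintype.card (S × A) * D * (T + 1)) / (k + ξ) by ring,
      Real.sqrt_div' _ (by positivity), Real.sqrt_mul (sq_nonneg _), Real.sqrt_sq (by positivity)]
    ring

/-- The finite-time error bound, in terms of a bound `T` for the mixing times before time `k`. -/
theorem integral_supNorm_qIter_sub_le
    (hX : IsMarkovChain ℙ (chain M β) X) (hr : ∀ s a s', |M.r s a s'| ≤ 1)
    (hQ₀ : ∀ y, |Q₀ y| ≤ 1) (hd : ∀ y, 0 ≤ d y) (hd1 : ∀ y, d y ≤ 1) (hD : ∀ y, 1 ≤ D * d y)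
    (hD1 : 1 ≤ D) (hθ : ∀ y, 2 ≤ θ * d y) (hξ : 2 ≤ ξ) (hθξ : θ ≤ ξ) (hT : 0 ≤ T)
    (hmix : ∀ j, k₀ ≤ j → j < k → ∃ t : ℕ, t ≤ j ∧ (t : ℝ) ≤ T
      ∧ (∀ x y, |(chain M β ^ t) x y - d y| ≤ stepSize θ ξ j)
      ∧ stepSize θ ξ (j - t) ≤ 2 * stepSize θ ξ j)
    {dmin dmax : ℝ} (hdmin : ∀ y, dmin ≤ d y)
    (hdmax : ∀ y, d y ≤ dmax) (hdmin0 : 0 < dmin) (hθ' : 2 ≤ θ * dmin * (1 - M.γ))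
    (hk : k₀ ≤ k) :
    ∫ ω, supNorm (qIter M (stepSize θ ξ) Q₀ (fun i => X i ω) k - qStar M) ∂ℙ
      ≤ ((θ * dmax + 1) * (12 * (1 / (1 - M.γ)) * √(Fintype.card (S × A) * D * (T + 1)) * θ)
        + 2 * (1 / (1 - M.γ)) * √(k₀ + ξ)) / √(k + ξ) := by
  have hγ : 0 < 1 - M.γ := sub_pos.2 M.γ_lt_one
  have hθ0 : 0 < θ := by
    by_contra! h
    have : θ * dmin ≤ 0 := mul_nonpos_of_nonpos_of_nonneg h hdmin0.le
    nlinarith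
  have hdmax0 : 0 < dmax :=
    hdmin0.trans_le ((hdmin (Classical.arbitrary _)).trans (hdmax (Classical.arbitrary _)))
  set W := 12 * (1 / (1 - M.γ)) * √(Fintype.card (S × A) * D * (T + 1)) * θ
  have hW : 0 ≤ W := by positivity
  set U : Ω → ℕ → S × A → ℝ := fun ω => filteredNoise M (stepSize θ ξ) Q₀ d k₀ (fun i => X i ω)
  set Q : Ω → ℕ → S × A → ℝ := fun ω => qIter M (stepSize θ ξ) Q₀ (fun i => X i ω)
  have hα0 := stepSize_nonneg hθ0.le (show 0 ≤ ξ by linarith)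
  have hα1 := stepSize_le_one (show 0 < ξ by linarith) hθξ
  have hUint : ∀ j, Integrable (fun ω => supNorm (U ω j)) ℙ := fun j =>
    hX.integrable (dependsOn_comp_qIter_filteredNoise j fun _ U _ => supNorm U)
  have hZint : ∀ j, Integrable (fun ω => supNorm (Q ω j - qStar M - U ω j)) ℙ := fun j =>
    hX.integrable (dependsOn_comp_qIter_filteredNoise j fun Q U _ => supNorm (Q - qStar M - U))
  have hQint : Integrable (fun ω => supNorm (Q ω k - qStar M)) ℙ :=
    hX.integrable (dependsOn_comp_qIter_filteredNoise (k₀ := k₀) (d := d) k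
      fun Q _ _ => supNorm (Q - qStar M))
  have hU : ∀ j, k₀ ≤ j → j ≤ k → ∫ ω, supNorm (U ω j) ∂ℙ ≤ W / √(j + ξ) := fun j hj hjk =>
    integral_supNorm_filteredNoise_le hX hr hQ₀ hd hd1 hD hD1 hθ hξ hθξ hT
      (fun i hi hij => hmix i hi (hij.trans_le hjk)) hj
  have hZ : ∫ ω, supNorm (Q ω k - qStar M - U ω k) ∂ℙ
      ≤ (θ * dmax * W + 2 * (1 / (1 - M.γ)) * √(k₀ + ξ)) / √(k + ξ) := by
    refine le_div_sqrt_of_recursion (z := fun k => ∫ ω, supNorm (Q ω k - qStar M - U ω k) ∂ℙ) hξ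
      (by positivity) (by positivity) ?_ hk fun j hj hjk => ?_
    · have hle : ∀ ω, supNorm (Q ω k₀ - qStar M - U ω k₀) ≤ 2 * (1 / (1 - M.γ)) := by
        intro ω
        refine supNorm_le fun y => ?_
        simp only [U, filteredNoise_eq_zero le_rfl, sub_zero, Pi.sub_apply, Pi.zero_apply]
        have h1 := abs_qIter_le (x := fun i => X i ω) hr hQ₀ hα0 hα1 k₀ y
        have h2 := abs_qStar_le M hr y
        refine (abs_sub _ _).trans ?_
        linarith
      refine (integral_mono (hZint k₀) (integrable_const _) hle).trans_eq ?_
      simp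
    · have hj0 : (0 : ℝ) < j + ξ := by positivity
      have hle : ∀ ω, supNorm (Q ω (j + 1) - qStar M - U ω (j + 1))
          ≤ (1 - stepSize θ ξ j * dmin * (1 - M.γ)) * supNorm (Q ω j - qStar M - U ω j)
            + stepSize θ ξ j * dmax * supNorm (U ω j) := fun ω =>
        supNorm_sub_filteredNoise_succ_le hα0 hα1 hdmin0.le hdmin hdmax hd1 hj
      have h1 := integral_mono (hZint (j + 1))
        (((hZint j).const_mul _).add ((hUint j).const_mul _)) hle
      have h2 := integral_add (μ := ℙ)
        ((hZint j).const_mul (1 - stepSize θ ξ j * dmin * (1 - M.γ)))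
        ((hUint j).const_mul (stepSize θ ξ j * dmax))
      simp only [Pi.add_apply] at h1
      rw [h2, integral_const_mul, integral_const_mul] at h1
      refine h1.trans (add_le_add (mul_le_mul_of_nonneg_right ?_
        (integral_nonneg fun ω => supNorm_nonneg _)) ?_)
      -- The lower bound on `θ` is calibrated for this: the pathwise contraction gains at least `2 /
      -- (j + ξ)`.
      · have : 2 / (j + ξ) ≤ stepSize θ ξ j * dmin * (1 - M.γ) := by
          rw [stepSize, div_mul_eq_mul_div, div_mul_eq_mul_div]
          exact div_le_div_of_nonneg_right hθ' hj0.le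
        linarith
      · have h3 := mul_le_mul_of_nonneg_left (hU j hj hjk.le)
          (mul_nonneg (hα0 j) hdmax0.le)
        refine h3.trans_eq ?_
        rw [stepSize, div_mul_eq_mul_div, div_mul_div_comm]
  have hsum : ∫ ω, supNorm (Q ω k - qStar M) ∂ℙ
      ≤ ∫ ω, supNorm (Q ω k - qStar M - U ω k) ∂ℙ + ∫ ω, supNorm (U ω k) ∂ℙ := by
    rw [← integral_add (hZint k) (hUint k)]
    refine integral_mono hQint ((hZint k).add (hUint k)) fun ω => ?_
    have := supNorm_add_le (Q ω k - qStar M - U ω k) (U ω k)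
    rwa [sub_add_cancel] at this
  refine (hsum.trans (add_le_add hZ (hU k hk le_rfl))).trans_eq ?_
  rw [← add_div]
  congr 1
  ring

end

/-! ### Logarithmic growth of the mixing time and control of `kMix`. -/

section MixingTime

variable {m ρ : ℝ}

lemma mixTime_le {c' : ℝ} {k : ℕ} (h : m * ρ ^ k ≤ c') : mixTime m ρ c' ≤ k := Nat.sInf_le h

/-- The set defining `mixTime` is nonempty because `ρ < 1`, so its infimum is attained. -/
lemma mul_pow_mixTime_le (hρ : 0 ≤ ρ) (hρ1 : ρ < 1) {c' : ℝ} (hc : 0 < c') :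
    m * ρ ^ mixTime m ρ c' ≤ c' := by
  refine Nat.sInf_mem (s := {k : ℕ | m * ρ ^ k ≤ c'}) ?_
  have h : Tendsto (fun k : ℕ => m * ρ ^ k) atTop (nhds (m * 0)) :=
    (tendsto_pow_atTop_nhds_zero_of_lt_one hρ hρ1).const_mul m
  rw [mul_zero] at h
  exact (h.eventually (eventually_le_nhds hc)).exists

lemma mixTime_mono (hρ : 0 ≤ ρ) (hρ1 : ρ < 1) {c₁ c₂ : ℝ} (hc : 0 < c₁) (h : c₁ ≤ c₂) :
    mixTime m ρ c₂ ≤ mixTime m ρ c₁ :=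
  mixTime_le ((mul_pow_mixTime_le hρ hρ1 hc).trans h)

lemma mixTime_le_log (hm : 0 < m) (hρ : 0 < ρ) (hρ1 : ρ < 1) {c' : ℝ} (hc : 0 < c') :
    (mixTime m ρ c' : ℝ) ≤ |Real.log (m / c')| / (-Real.log ρ) + 1 := by
  have hL : 0 < -Real.log ρ := neg_pos.2 (Real.log_neg hρ hρ1)
  have hk := Nat.le_ceil (|Real.log (m / c')| / (-Real.log ρ))
  have hk1 := Nat.ceil_lt_add_one (div_nonneg (abs_nonneg (Real.log (m / c'))) hL.le)
  set k := ⌈|Real.log (m / c')| / (-Real.log ρ)⌉₊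
  have h : mixTime m ρ c' ≤ k := by
    refine mixTime_le ((Real.log_le_log_iff (by positivity) hc).1 ?_)
    rw [Real.log_mul hm.ne' (by positivity), Real.log_pow]
    rw [div_le_iff₀ hL] at hk
    have h1 := le_abs_self (Real.log (m / c'))
    rw [Real.log_div hm.ne' hc.ne'] at h1 hk
    linarith
  have : (mixTime m ρ c' : ℝ) ≤ k := by exact_mod_cast h
  linarith

lemma stepSize_pos {θ ξ : ℝ} (hθ : 0 < θ) (hξ : 0 < ξ) (k : ℕ) : 0 < stepSize θ ξ k := by
  unfold stepSize; positivity

lemma mixTime_stepSize_mono {θ ξ : ℝ} (hρ : 0 ≤ ρ) (hρ1 : ρ < 1) (hθ : 0 < θ) (hξ : 0 < ξ)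
    {i j : ℕ} (hij : i ≤ j) :
    mixTime m ρ (stepSize θ ξ i) ≤ mixTime m ρ (stepSize θ ξ j) :=
  mixTime_mono hρ hρ1 (stepSize_pos hθ hξ j) (antitone_stepSize hθ.le hξ hij)

lemma exists_eventually_mixTime_le (hm : 0 < m) (hρ : 0 < ρ) (hρ1 : ρ < 1) {θ ξ : ℝ} (hθ : 0 < θ)
    (hξ : 0 < ξ) : ∃ b : ℝ, 0 ≤ b ∧
      ∀ᶠ k : ℕ in atTop, (mixTime m ρ (stepSize θ ξ k) : ℝ) ≤ b * Real.log k := by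
  have hL : 0 < -Real.log ρ := neg_pos.2 (Real.log_neg hρ hρ1)
  refine ⟨(|Real.log (m / θ)| + 2) / (-Real.log ρ) + 1, by positivity, ?_⟩
  have hlog : ∀ᶠ k : ℕ in atTop, 1 ≤ Real.log k :=
    (Real.tendsto_log_atTop.comp tendsto_natCast_atTop_atTop).eventually_ge_atTop 1
  have hbig : ∀ᶠ k : ℕ in atTop, ξ + 1 ≤ (k : ℝ) :=
    (tendsto_natCast_atTop_atTop (R := ℝ)).eventually_ge_atTop _
  filter_upwards [hlog, hbig] with k h1 h2
  refine (mixTime_le_log hm hρ hρ1 (stepSize_pos hθ hξ k)).trans ?_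
  have hk : (0 : ℝ) < k := by linarith
  have h3 : m / stepSize θ ξ k = m / θ * (k + ξ) := by
    rw [stepSize]; field_simp
  have h4 : Real.log (k + ξ) ≤ 2 * Real.log k := by
    rw [show 2 * Real.log k = ((2 : ℕ) : ℝ) * Real.log k by norm_num, ← Real.log_pow]
    exact Real.log_le_log (by positivity) (by nlinarith)
  have h5 : 0 ≤ Real.log (k + ξ) := Real.log_nonneg (by linarith)
  have h6 : |Real.log (m / stepSize θ ξ k)| ≤ (|Real.log (m / θ)| + 2) * Real.log k := by
    rw [h3, Real.log_mul (by positivity) (by positivity)]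
    refine (abs_add_le _ _).trans ?_
    rw [abs_of_nonneg h5]
    nlinarith [abs_nonneg (Real.log (m / θ))]
  rw [add_mul, one_mul, div_mul_eq_mul_div]
  gcongr

/-- Logarithmic growth is eventually beaten by `t / 2`. Thus the set defining `kMix` is nonempty and
`kMix` is a genuine minimum, not the default value `0` of `sInf ∅`. -/
lemma exists_forall_two_mul_mixTime_le (hm : 0 < m) (hρ : 0 < ρ) (hρ1 : ρ < 1) {θ ξ : ℝ}
    (hθ : 0 < θ) (hξ : 0 < ξ) :
    ∃ k, ∀ t, k ≤ t → 2 * mixTime m ρ (stepSize θ ξ t) ≤ t := by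
  obtain ⟨b, hb, h⟩ := exists_eventually_mixTime_le hm hρ hρ1 hθ hξ
  have hlog := (Real.isLittleO_log_id_atTop.comp_tendsto
    (tendsto_natCast_atTop_atTop (R := ℝ))).def (c := 1 / (2 * b + 1)) (by positivity)
  have hbig : ∀ᶠ k : ℕ in atTop, 1 ≤ k := eventually_ge_atTop 1
  obtain ⟨k, hk⟩ := eventually_atTop.1 (h.and (hlog.and hbig))
  refine ⟨k, fun t ht => ?_⟩
  obtain ⟨h1, h2, h3⟩ := hk t ht
  have h4 : (1 : ℝ) ≤ t := by exact_mod_cast h3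
  simp only [Function.comp_apply, id, Real.norm_eq_abs, abs_of_nonneg (Real.log_nonneg h4),
    Nat.abs_cast] at h2
  rw [one_div, inv_mul_eq_div, le_div_iff₀ (by positivity)] at h2
  have h5 := Real.log_nonneg h4
  have : (2 * mixTime m ρ (stepSize θ ξ t) : ℝ) ≤ t := by linarith
  exact_mod_cast this

lemma two_mul_mixTime_le {α : ℕ → ℝ} (h : ∃ k, ∀ t, k ≤ t → 2 * mixTime m ρ (α t) ≤ t) {t : ℕ}
    (ht : kMix m ρ α ≤ t) : 2 * mixTime m ρ (α t) ≤ t :=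
  Nat.sInf_mem (s := {k : ℕ | ∀ t, k ≤ t → 2 * mixTime m ρ (α t) ≤ t}) h t ht

/-- By minimality the defining condition fails from `kMix - 1` on, hence at `t = kMix - 1` itself,
where the mixing time is at most that at `k`. The start-up time can therefore be charged to the
mixing-time term of the bound. -/
lemma kMix_le {α : ℕ → ℝ} (h : ∃ k, ∀ t, k ≤ t → 2 * mixTime m ρ (α t) ≤ t)
    (hmono : Monotone fun k => mixTime m ρ (α k)) {k : ℕ} (hk : kMix m ρ α ≤ k) :
    kMix m ρ α ≤ 1 + 2 * mixTime m ρ (α k) := by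
  by_contra! hlt
  have hnot : kMix m ρ α - 1 ∉ {k : ℕ | ∀ t, k ≤ t → 2 * mixTime m ρ (α t) ≤ t} :=
    Nat.notMem_of_lt_sInf (show kMix m ρ α - 1 < kMix m ρ α by omega)
  refine hnot fun t ht => ?_
  rcases Nat.lt_or_ge t (kMix m ρ α) with h1 | h1
  · have : mixTime m ρ (α t) ≤ mixTime m ρ (α k) := hmono (h1.le.trans hk)
    omega
  · exact two_mul_mixTime_le h h1

end MixingTime

/-- Here `n = |S||A|`, `H = 1/(1-γ)`, `D = 1/dMin μ`, `δ = dMax μ`, `τ` is the mixing time at `k`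
and `k₀ = kMix`. The powers `H ^ 4 * D ^ 3` come from `H √ξ`, of order `H (nHD)³`. Noise terms use
`√(nD) ≤ D`, and `n ≤ n² δ` lets terms without `δ` be charged to the one with `δ`. -/
lemma finite_time_constant_le {n H D δ c θ ξ τ k₀ : ℝ} (hn : 1 ≤ n) (hH : 1 ≤ H) (hD : 1 ≤ D)
    (hnD : n ≤ D) (hδ : 0 ≤ δ) (hδ1 : δ ≤ 1) (hnδ : 1 ≤ n * δ) (hc : 1 ≤ c) (hθ : 0 ≤ θ)
    (hθc : θ ≤ c * (n * H * D)) (hξ : ξ ≤ c * (n * H * D) ^ 6) (hτ : 0 ≤ τ)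
    (hk₀ : k₀ ≤ 1 + 2 * τ) :
    (θ * δ + 1) * (12 * H * √(n * D * (τ + 1)) * θ) + 2 * H * √(k₀ + ξ)
      ≤ 28 * c ^ 2 * (n ^ (15 / 4 : ℝ) * H ^ 4 * D ^ 3)
        + 28 * c ^ 2 * (n ^ (33 / 8 : ℝ) * δ * H ^ 4 * D ^ 3) * √τ := by
  have hn3 : n ^ 3 ≤ n ^ (15 / 4 : ℝ) := by
    rw [← Real.rpow_natCast]
    exact Real.rpow_le_rpow_of_exponent_le hn (by norm_num)
  have hn2 : n ^ 2 ≤ n ^ (33 / 8 : ℝ) := by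
    rw [← Real.rpow_natCast]
    exact Real.rpow_le_rpow_of_exponent_le hn (by norm_num)
  set p := n ^ (15 / 4 : ℝ)
  set q := n ^ (33 / 8 : ℝ)
  set s := √τ
  have hs : 0 ≤ s := Real.sqrt_nonneg τ
  have hs2 : s ^ 2 = τ := Real.sq_sqrt hτ
  have hcc : c ≤ c ^ 2 := le_self_pow₀ hc two_ne_zero
  have h1cc : 1 ≤ c ^ 2 := one_le_pow₀ hc
  have hnn3 : n ≤ n ^ 3 := le_self_pow₀ hn (by norm_num)
  have hn23 : n ^ 2 ≤ n ^ 3 := pow_le_pow_right₀ hn (by norm_num)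
  have hp1 : 1 ≤ p := (one_le_pow₀ hn).trans hn3
  have hqδ : n ≤ q * δ := by
    calc n ≤ n * (n * δ) := le_mul_of_one_le_right (by linarith) hnδ
      _ = n ^ 2 * δ := by ring
      _ ≤ q * δ := by gcongr
  have hroot : √(n * D * (τ + 1)) ≤ D * (s + 1) := by
    refine Real.sqrt_le_iff.2 ⟨by positivity, ?_⟩
    calc n * D * (τ + 1) ≤ D * D * ((s + 1) ^ 2) := by
          gcongr
          rw [← hs2]; nlinarith
      _ = (D * (s + 1)) ^ 2 := by ring
  have hroot' : √(k₀ + ξ) ≤ 1 + 2 * s + c * (n * H * D) ^ 3 := by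
    refine Real.sqrt_le_iff.2 ⟨by positivity, ?_⟩
    have h1 : c * (n * H * D) ^ 6 ≤ (c * (n * H * D) ^ 3) ^ 2 := by
      calc _ ≤ c ^ 2 * (n * H * D) ^ 6 := by gcongr
        _ = _ := by ring
    have h2 : 0 ≤ (1 + 2 * s) * (c * (n * H * D) ^ 3) := by positivity
    nlinarith
  have hW : 12 * H * √(n * D * (τ + 1)) * θ ≤ 12 * c * (n * H ^ 2 * D ^ 2) * (s + 1) := by
    calc _ ≤ 12 * H * (D * (s + 1)) * (c * (n * H * D)) := by gcongr
      _ = _ := by ring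
  have hfactor : θ * δ + 1 ≤ c * (n * H * D) * δ + 1 := by gcongr
  have hH4 : H ^ 3 ≤ H ^ 4 := pow_le_pow_right₀ hH (by norm_num)
  have hH24 : H ^ 2 ≤ H ^ 4 := pow_le_pow_right₀ hH (by norm_num)
  have hH14 : H ≤ H ^ 4 := le_self_pow₀ hH (by norm_num)
  have hD23 : D ^ 2 ≤ D ^ 3 := pow_le_pow_right₀ hD (by norm_num)
  have hD13 : 1 ≤ D ^ 3 := one_le_pow₀ hD
  set R := H ^ 4 * D ^ 3 with hR
  have hR1 : H ^ 3 * D ^ 3 ≤ R := by rw [hR]; gcongr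
  have hR2 : H ^ 2 * D ^ 2 ≤ R := by rw [hR]; gcongr
  have hR3 : H ≤ R := hH14.trans (le_mul_of_one_le_right (by positivity) hD13)
  have hR0 : 0 ≤ R := by positivity
  have e1 : n ^ 2 * δ * (H ^ 3 * D ^ 3) ≤ q * δ * R := by gcongr
  have e2 : n ^ 2 * δ * (H ^ 3 * D ^ 3) ≤ p * R := by
    calc _ ≤ p * 1 * R := by
          gcongr
          exact hn23.trans hn3
      _ = _ := by ring
  have e3 : n * (H ^ 2 * D ^ 2) ≤ q * δ * R := by gcongr
  have e4 : n * (H ^ 2 * D ^ 2) ≤ p * R := by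
    gcongr
    exact hnn3.trans hn3
  have e5 : H ≤ p * R := hR3.trans (le_mul_of_one_le_left hR0 hp1)
  have e6 : H ≤ q * δ * R := hR3.trans (le_mul_of_one_le_left hR0 (hn.trans hqδ))
  have e7 : n ^ 3 * R ≤ p * R := by gcongr
  calc _ ≤ (c * (n * H * D) * δ + 1) * (12 * c * (n * H ^ 2 * D ^ 2) * (s + 1))
        + 2 * H * (1 + 2 * s + c * (n * H * D) ^ 3) := by gcongr
    _ = 12 * c ^ 2 * (n ^ 2 * δ * (H ^ 3 * D ^ 3)) + 12 * c * (n * (H ^ 2 * D ^ 2)) + 2 * 1 * H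
          + 2 * c * (n ^ 3 * R)
        + (12 * c ^ 2 * (n ^ 2 * δ * (H ^ 3 * D ^ 3)) + 12 * c * (n * (H ^ 2 * D ^ 2))
          + 4 * 1 * H) * s := by rw [hR]; ring
    -- The coefficients add up to `12 + 12 + 2 + 2 = 28` without `s` and `12 + 12 + 4 = 28` with it.
    _ ≤ 12 * c ^ 2 * (p * R) + 12 * c ^ 2 * (p * R) + 2 * c ^ 2 * (p * R)
          + 2 * c ^ 2 * (p * R)
        + (12 * c ^ 2 * (q * δ * R) + 12 * c ^ 2 * (q * δ * R)
          + 4 * c ^ 2 * (q * δ * R)) * s := by gcongr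
    _ = _ := by rw [hR]; ring

/-! ### The bound in terms of the parameters of the decision process. -/

section Rate

variable {S A : Type*} [Fintype S] [Fintype A] [DecidableEq S] [DecidableEq A] [Nonempty S]
  [Nonempty A]

lemma nPairs_eq_card : nPairs S A = Fintype.card (S × A) := by
  rw [nPairs, Fintype.card_prod, Nat.cast_mul]

lemma one_le_nPairs : 1 ≤ nPairs S A := by
  rw [nPairs_eq_card]
  exact_mod_cast Fintype.card_pos

lemma dMin_le {ι : Type*} [Finite ι] (μ : ι → ℝ) (y : ι) : dMin μ ≤ μ y :=
  ciInf_le (Set.finite_range μ).bddBelow y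

lemma le_dMax {ι : Type*} [Finite ι] (μ : ι → ℝ) (y : ι) : μ y ≤ dMax μ :=
  le_ciSup (Set.finite_range μ).bddAbove y

lemma dMin_pos {ι : Type*} [Finite ι] [Nonempty ι] {μ : ι → ℝ} (h : ∀ y, 0 < μ y) :
    0 < dMin μ := by
  obtain ⟨y, hy⟩ := exists_eq_ciInf_of_finite (f := μ)
  rw [dMin, ← hy]
  exact h y

lemma card_mul_dMin_le {ι : Type*} [Fintype ι] {μ : ι → ℝ} (h : ∑ y, μ y = 1) :
    Fintype.card ι * dMin μ ≤ 1 := by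
  rw [← h, ← nsmul_eq_mul, ← Finset.card_univ]
  exact Finset.card_nsmul_le_sum _ _ _ fun y _ => dMin_le μ y

lemma one_le_card_mul_dMax {ι : Type*} [Fintype ι] {μ : ι → ℝ} (h : ∑ y, μ y = 1) :
    1 ≤ Fintype.card ι * dMax μ := by
  rw [← h, ← nsmul_eq_mul, ← Finset.card_univ]
  exact Finset.sum_le_card_nsmul _ _ _ fun y _ => le_dMax μ y

/-- The finite-time error bound of asynchronous Q-learning with a rescaled linear step-size. -/
theorem integral_supNorm_qIter_sub_qStar_le {M : MDP S A} (hr : ∀ s a s', |M.r s a s'| ≤ 1)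
    {β : Policy S A} {μ : S × A → ℝ} (hμ : IsStationary (chain M β) μ) (hμpos : ∀ y, 0 < μ y)
    {m ρ : ℝ} (hmix : GeometricMixing (chain M β) μ m ρ) {θ ξ c : ℝ} (hc : 1 ≤ c)
    (hθ : 2 / ((1 - M.γ) * dMin μ) ≤ θ)
    (hθc : θ ≤ c * (nPairs S A / ((1 - M.γ) * dMin μ))) (hθξ : θ ≤ ξ)
    (hξ : ξ ≤ c * (nPairs S A / ((1 - M.γ) * dMin μ)) ^ 6)
    {Q₀ : S × A → ℝ} (hQ₀ : ∀ y, |Q₀ y| ≤ 1)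
    {Ω : Type*} [MeasurableSpace Ω] {ℙ : Measure Ω} [IsProbabilityMeasure ℙ]
    {X : ℕ → Ω → S × A} (hX : IsMarkovChain ℙ (chain M β) X) {k : ℕ}
    (hk : kMix m ρ (stepSize θ ξ) ≤ k) :
    ∫ ω, supNorm (qIter M (stepSize θ ξ) Q₀ (fun i => X i ω) k - qStar M) ∂ℙ
      ≤ 28 * c ^ 2 * (nPairs S A ^ (15 / 4 : ℝ) / ((1 - M.γ) ^ 4 * dMin μ ^ 3)) / √(k + ξ)
        + 28 * c ^ 2 * nPairs S A ^ (33 / 8 : ℝ) * dMax μ / ((1 - M.γ) ^ 4 * dMin μ ^ 3)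
          * (√(mixTime m ρ (stepSize θ ξ k)) / √(k + ξ)) := by
  have hγ : 0 < 1 - M.γ := sub_pos.2 M.γ_lt_one
  have hδ : 0 < dMin μ := dMin_pos hμpos
  have hγδ : 0 < (1 - M.γ) * dMin μ := mul_pos hγ hδ
  have hn : 1 ≤ nPairs S A := one_le_nPairs
  have hnmin : nPairs S A * dMin μ ≤ 1 := by
    rw [nPairs_eq_card]; exact card_mul_dMin_le hμ.sum_eq_one
  have hnmax : 1 ≤ nPairs S A * dMax μ := by
    rw [nPairs_eq_card]; exact one_le_card_mul_dMax hμ.sum_eq_one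
  have hdmax1 : dMax μ ≤ 1 := ciSup_le fun y => hμ.le_one y
  have hdmax0 : 0 ≤ dMax μ := (hμ.nonneg (Classical.arbitrary _)).trans (le_dMax μ _)
  have hnD : nPairs S A ≤ 1 / dMin μ := by rwa [le_div_iff₀ hδ]
  have hD : 1 ≤ 1 / dMin μ := hn.trans hnD
  have hD' : ∀ y, 1 ≤ 1 / dMin μ * μ y := fun y => by
    rw [one_div_mul_eq_div, le_div_iff₀ hδ, one_mul]; exact dMin_le μ y
  have hθ0 : 0 < θ := (div_pos two_pos hγδ).trans_le hθ
  have hθ1 : 2 ≤ θ * dMin μ * (1 - M.γ) := by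
    rw [div_le_iff₀ hγδ] at hθ
    linarith
  have hθ2 : ∀ y, 2 ≤ θ * μ y := fun y => by
    have h1 : θ * dMin μ ≤ θ * μ y := mul_le_mul_of_nonneg_left (dMin_le μ y) hθ0.le
    have h2 : θ * dMin μ * (1 - M.γ) ≤ θ * dMin μ :=
      mul_le_of_le_one_right (by positivity) (by linarith [M.γ_nonneg])
    linarith
  have hθ3 : 2 ≤ θ := by
    have y : S × A := Classical.arbitrary _
    have := mul_le_of_le_one_right hθ0.le (hμ.le_one y)
    linarith [hθ2 y]
  have hξ0 : 0 < ξ := hθ0.trans_le hθξ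
  have hexists := exists_forall_two_mul_mixTime_le hmix.m_pos hmix.ρ_pos hmix.ρ_lt_one hθ0 hξ0
  have hmono : Monotone fun k => mixTime m ρ (stepSize θ ξ k) := fun i j hij =>
    mixTime_stepSize_mono hmix.ρ_pos.le hmix.ρ_lt_one hθ0 hξ0 hij
  set τ := mixTime m ρ (stepSize θ ξ k)
  set k₀ := kMix m ρ (stepSize θ ξ)
  have hk₀ : (k₀ : ℝ) ≤ 1 + 2 * τ := by exact_mod_cast kMix_le hexists hmono hk
  have hmain := integral_supNorm_qIter_sub_le (T := τ) hX hr hQ₀ hμ.nonneg hμ.le_one hD' hD hθ2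
    (hθ3.trans hθξ) hθξ (Nat.cast_nonneg τ) (k₀ := k₀) (k := k) (fun j hj hjk => ?_)
    (dMin_le μ) (le_dMax μ) hδ hθ1 hk
  · have hconst := finite_time_constant_le (k₀ := k₀) (θ := θ) (ξ := ξ) hn M.one_le_horizon hD hnD
      hdmax0 hdmax1 hnmax hc hθ0.le (hθc.trans_eq (by field_simp)) (hξ.trans_eq (by field_simp))
      (Nat.cast_nonneg τ) hk₀
    rw [← nPairs_eq_card] at hmain
    refine hmain.trans ((div_le_div_of_nonneg_right hconst (Real.sqrt_nonneg _)).trans_eq ?_)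
    rw [add_div]
    congr 1
    · field_simp
    · field_simp
  · refine ⟨mixTime m ρ (stepSize θ ξ j), ?_, ?_, fun x y => ?_, ?_⟩
    · have := two_mul_mixTime_le hexists hj
      omega
    · exact_mod_cast hmono hjk.le
    · exact (hmix.abs_pow_sub_le _ x y).trans
        (mul_pow_mixTime_le hmix.ρ_pos.le hmix.ρ_lt_one (stepSize_pos hθ0 hξ0 j))
    -- From `2t ≤ j` follows `j + ξ ≤ 2(j - t + ξ)`: going back one mixing time at most doubles the
    -- step-size. This is the role of the factor `2` in `kMix`.
    · have h1 := two_mul_mixTime_le hexists hj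
      set t := mixTime m ρ (stepSize θ ξ j)
      have h2 : (2 * t : ℝ) ≤ j := by exact_mod_cast h1
      have h3 : (0 : ℝ) ≤ t := Nat.cast_nonneg t
      rw [stepSize, stepSize, Nat.cast_sub (by omega), ← mul_div_assoc,
        div_le_div_iff₀ (by linarith) (by linarith)]
      nlinarith

end Rate

end QLearning

/-! ### The main theorem. -/

theorem mainTheorem1 (c : ℝ) :
    -- `C` depends only on the constant `c` in the admissible range of the step-size
    ∃ C : ℝ, 0 < C ∧
      ∀ (S : Type*) (A : Type*) [Fintype S] [Fintype A] [DecidableEq S] [DecidableEq A]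
        [Nonempty S] [Nonempty A]
        (M : QLearning.MDP S A) (_ : ∀ s a s', |M.r s a s'| ≤ 1)
        (β : QLearning.Policy S A)
        (_ : (QLearning.chain M β).IsIrreducible)
        (_ : QLearning.IsAperiodic (QLearning.chain M β))
        (μ : S × A → ℝ) (_ : QLearning.IsStationary (QLearning.chain M β) μ),
        -- the chain mixes geometrically
        (∃ m ρ : ℝ, QLearning.GeometricMixing (QLearning.chain M β) μ m ρ) ∧
        ∀ (m ρ : ℝ) (_ : QLearning.GeometricMixing (QLearning.chain M β) μ m ρ)
          (θ ξ : ℝ)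
          (_ : 2 / ((1 - M.γ) * QLearning.dMin μ) ≤ θ)
          (_ : θ ≤ c * (QLearning.nPairs S A / ((1 - M.γ) * QLearning.dMin μ)))
          (_ : θ ≤ ξ)
          (_ : ξ ≤ c * (QLearning.nPairs S A / ((1 - M.γ) * QLearning.dMin μ)) ^ 6),
          -- the mixing time is logarithmic
          (fun k : ℕ => (QLearning.mixTime m ρ (QLearning.stepSize θ ξ k) : ℝ))
            =O[atTop] (fun k : ℕ => Real.log k) ∧
          ∀ (Q₀ QL₀ : S × A → ℝ) (_ : ∀ x, |Q₀ x| ≤ 1) (_ : ∀ x, |QL₀ x| ≤ 1)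
            (_ : ∀ x, QL₀ x ≤ Q₀ x)
            (Ω : Type*) [MeasurableSpace Ω] (ℙ : Measure Ω) [IsProbabilityMeasure ℙ]
            (X : ℕ → Ω → S × A)
            (_ : QLearning.IsMarkovChain ℙ (QLearning.chain M β) X),
            let err : ℕ → Ω → ℝ := fun k ω => QLearning.supNorm
              (QLearning.qIter M (QLearning.stepSize θ ξ) Q₀ (fun i => X i ω) k
                - QLearning.qStar M)
            (∀ k, Integrable (err k) ℙ) ∧
            (∀ k : ℕ, QLearning.kMix m ρ (QLearning.stepSize θ ξ) ≤ k →
              ∫ ω, err k ω ∂ℙ ≤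
                QLearning.cStar M μ QL₀ C / √(k + ξ)
                + C * QLearning.nPairs S A ^ (33 / 8 : ℝ) * QLearning.dMax μ
                    / ((1 - M.γ) ^ 4 * QLearning.dMin μ ^ 3)
                  * (√(QLearning.mixTime m ρ (QLearning.stepSize θ ξ k) : ℝ) / √(k + ξ))) ∧
            (fun k : ℕ => ∫ ω, err k ω ∂ℙ)
              =O[atTop] (fun k : ℕ => √(Real.log k / k)) := by
  -- Replacing `c` by `max c 1` only widens the admissible range and provides the `1 ≤ c` under
  -- which the constants were compared.
  refine ⟨28 * max c 1 ^ 2, by positivity, ?_⟩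
  intro S A _ _ _ _ _ _ M hr β hirr hap μ hμ
  have hK := QLearning.chain_mem_rowStochastic M β
  have hμpos := hμ.pos hK hirr
  refine ⟨QLearning.exists_geometricMixing hK hirr hap hμ, ?_⟩
  intro m ρ hmix θ ξ hθ hθc hθξ hξ
  have hγ : 0 < 1 - M.γ := sub_pos.2 M.γ_lt_one
  have hδ : 0 < QLearning.dMin μ := QLearning.dMin_pos hμpos
  have hn : 1 ≤ QLearning.nPairs S A := QLearning.one_le_nPairs
  have hθ0 : 0 < θ := (div_pos two_pos (mul_pos hγ hδ)).trans_le hθ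
  have hξ0 : 0 < ξ := hθ0.trans_le hθξ
  obtain ⟨b, hb, hlog⟩ :=
    QLearning.exists_eventually_mixTime_le hmix.m_pos hmix.ρ_pos hmix.ρ_lt_one hθ0 hξ0
  refine ⟨IsBigO.of_bound b ?_, ?_⟩
  · filter_upwards [hlog] with k hk
    rw [Real.norm_of_nonneg (Nat.cast_nonneg _)]
    exact hk.trans (mul_le_mul_of_nonneg_left (Real.le_norm_self _) hb)
  intro Q₀ QL₀ hQ₀ _ _ Ω _ ℙ _ X hX err
  have hbound : ∀ k : ℕ, QLearning.kMix m ρ (QLearning.stepSize θ ξ) ≤ k → ∫ ω, err k ω ∂ℙ ≤ _ :=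
    fun k hk => QLearning.integral_supNorm_qIter_sub_qStar_le hr hμ hμpos hmix
      (le_max_right c 1) hθ
      (hθc.trans (mul_le_mul_of_nonneg_right (le_max_left c 1) (by positivity))) hθξ
      (hξ.trans (mul_le_mul_of_nonneg_right (le_max_left c 1) (by positivity))) hQ₀ hX hk
  refine ⟨fun k => ?_, fun k hk => (hbound k hk).trans ?_, ?_⟩
  · exact hX.integrable (k := k) (f := fun x => QLearning.supNorm
        (QLearning.qIter M (QLearning.stepSize θ ξ) Q₀ x k - QLearning.qStar M)) fun x x' h => by
      have h1 : QLearning.qIter M (QLearning.stepSize θ ξ) Q₀ x k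
          = QLearning.qIter M (QLearning.stepSize θ ξ) Q₀ x' k := QLearning.dependsOn_qIter k h
      simp only [h1]
  -- The first summand is bounded through the second entry of the maximum in `cStar`.
  · refine add_le_add_left (div_le_div_of_nonneg_right ?_ (Real.sqrt_nonneg _)) _
    exact mul_le_mul_of_nonneg_left (le_max_right _ _) (by positivity)
  · have hdmax0 : 0 ≤ QLearning.dMax μ :=
      (hμ.nonneg (Classical.arbitrary _)).trans (QLearning.le_dMax μ _)
    set a₁ := 28 * max c 1 ^ 2 * (QLearning.nPairs S A ^ (15 / 4 : ℝ)
      / ((1 - M.γ) ^ 4 * QLearning.dMin μ ^ 3)) with ha₁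
    set a₂ := 28 * max c 1 ^ 2 * QLearning.nPairs S A ^ (33 / 8 : ℝ) * QLearning.dMax μ
      / ((1 - M.γ) ^ 4 * QLearning.dMin μ ^ 3) with ha₂
    have h1 : 0 ≤ a₁ := by positivity
    have h2 : 0 ≤ a₂ := by positivity
    -- Eventually `log k ≥ 1`, so the term `a₁` is absorbed into `√(log k)`; the other one uses `τ ≤
    -- b log k`.
    refine IsBigO.of_bound (a₁ + a₂ * √b) ?_
    filter_upwards [hlog, eventually_ge_atTop (QLearning.kMix m ρ (QLearning.stepSize θ ξ)),
      (Real.tendsto_log_atTop.comp tendsto_natCast_atTop_atTop).eventually_ge_atTop 1,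
      eventually_ge_atTop 1] with k hk hk₀ hlog1 hk1
    have hk1' : (1 : ℝ) ≤ k := by exact_mod_cast hk1
    have hlog1' : 1 ≤ Real.log k := hlog1
    rw [Real.norm_of_nonneg (integral_nonneg fun ω => QLearning.supNorm_nonneg _),
      Real.norm_of_nonneg (Real.sqrt_nonneg _), Real.sqrt_div (by linarith)]
    refine (hbound k hk₀).trans ?_
    have h3 : 1 ≤ √(Real.log k) := Real.one_le_sqrt.2 hlog1'
    have h4 : √(QLearning.mixTime m ρ (QLearning.stepSize θ ξ k) : ℝ) ≤ √b * √(Real.log k) := by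
      rw [← Real.sqrt_mul hb]
      exact Real.sqrt_le_sqrt hk
    have h5 : 0 < √(k : ℝ) := Real.sqrt_pos.2 (by linarith)
    have h6 : √(k : ℝ) ≤ √(k + ξ) := Real.sqrt_le_sqrt (by linarith)
    calc _ ≤ a₁ / √(k : ℝ) + a₂ * ((√b * √(Real.log k)) / √(k : ℝ)) := by gcongr
      _ ≤ a₁ * √(Real.log k) / √(k : ℝ) + a₂ * ((√b * √(Real.log k)) / √(k : ℝ)) := by
          gcongr
          exact le_mul_of_one_le_right h1 h3
      _ = _ := by ring
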